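/- Let $(G,+)$ be a locally compact (Hausdorff) abelian group and let $H$ be a subgroup of the dual group $\hat G$. Equip $H$ with a (locally compact, Hausdorff) topology which makes it a locally compact group (not necessarily the subspace topology), and fix Haar measures on $G$ and $H$. Assume that $$\delta_h(f) = [g \mapsto h(g) f(g)] \quad (h \in H,\ f \in C_c(G)), \qquad \varepsilon_g(\tilde f) = [h \mapsto h(-g) \tilde f(h)] \quad (g \in G,\ \tilde f \in C_c(H))$$ map $C_c(G)$ into $C_c(G)$ and $C_c(H)$ into $C_c(H)$, and extend to strongly continuous actions $\delta$ of $H$ on the group C*-algebra $C^*(G)$ and $\varepsilon$ of $G$ on $C^*(H)$, respectively. Here, for a strongly continuous action $\alpha$ of a locally compact abelian group $S$ on a C*-algebra $A$, the (full) crossed product $A \rtimes_\alpha S$ is the completion of $C_c(S,A)$, with product $(f_1 * f_2)(s) = \int_S f_1(r)\, \alpha_r(f_2(r^{-1}s))\, dr$ and involution $f^*(s) = \alpha_s(f(s^{-1})^*)$, in the norm $\|f\| = \sup_\pi \|\pi(f)\|$, where $\pi$ runs through the nondegenerate *-representations of $L^1(S,A)$ on Hilbert spaces; $C^*(S) = \mathbb{C}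 \rtimes S$ for the trivial action. A function $f \in C_c(G \times H)$ is viewed as the element $h \mapsto f(\cdot,h) \in C_c(G) \to C^*(G)$ of $C^*(G) \rtimes_\delta H$, and similarly $C_c(H \times G)$ is mapped to $C^*(H) \rtimes_\varepsilon G$. Then $$\varphi : C_c(G \times H) \to C_c(H \times G), \qquad f \mapsto [(h,g) \mapsto h(-g) f(g,h)]$$ is well defined and extends to a *-isomorphism $C^*(G) \rtimes_\delta H \cong C^*(H) \rtimes_\varepsilon G$. -/

import Mathlib

open MeasureTheory Topology
open scoped CompactlySupported

universe u v

noncomputable section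

/-- A strongly continuous action of a topological group `G` on a C⋆-algebra `A` by
⋆-automorphisms. -/
structure CStarAction (G : Type u) (A : Type v) [Group G] [TopologicalSpace G]
    [NonUnitalCStarAlgebra A] where
  toHom : G →* (A ≃⋆ₐ[ℂ] A)
  continuous_apply : ∀ a : A, Continuous fun g => toHom g a

namespace CStarAction

variable {G : Type u} {A : Type v} [Group G] [TopologicalSpace G] [NonUnitalCStarAlgebra A]

instance : CoeFun (CStarAction G A) fun _ => G → (A ≃⋆ₐ[ℂ] A) := ⟨fun α => α.toHom⟩

/-- The trivial action. -/
def trivial (G : Type u) (A : Type v) [Group G] [TopologicalSpace G]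
    [NonUnitalCStarAlgebra A] : CStarAction G A where
  toHom := 1
  continuous_apply _ := continuous_const

variable (α : CStarAction G A)

theorem mul_apply (g h : G) (a : A) : α (g * h) a = α g (α h a) := by
  rw [map_mul]; rfl

theorem norm_apply (g : G) (a : A) : ‖α g a‖ = ‖a‖ := by
  apply le_antisymm (NonUnitalStarAlgHom.norm_apply_le (α g) a)
  have h := NonUnitalStarAlgHom.norm_apply_le (α g).symm (α g a)
  simpa using h

theorem continuous_uncurry : Continuous fun p : G × A => α p.1 p.2 := by
  rw [continuous_iff_continuousAt]
  rintro ⟨g, a⟩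
  rw [ContinuousAt, tendsto_iff_norm_sub_tendsto_zero]
  have h1 : Filter.Tendsto (fun p : G × A => ‖p.2 - a‖ + ‖α p.1 a - α g a‖) (𝓝 (g, a)) (𝓝 0) := by
    have : Continuous fun p : G × A => ‖p.2 - a‖ + ‖α p.1 a - α g a‖ := by
      have := (α.continuous_apply a).comp (continuous_fst (X := G) (Y := A))
      simp only [Function.comp_def] at this
      fun_prop
    simpa using this.tendsto (g, a)
  refine squeeze_zero (fun _ => norm_nonneg _) (fun p => ?_) h1
  have : α p.1 p.2 - α g a = α p.1 (p.2 - a) + (α p.1 a - α g a) := by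
    rw [map_sub]; abel
  rw [this]
  refine (norm_add_le _ _).trans ?_
  rw [α.norm_apply]

theorem continuous_comp {X : Type*} [TopologicalSpace X] {s : X → G} {a : X → A}
    (hs : Continuous s) (ha : Continuous a) : Continuous fun x => α (s x) (a x) :=
  α.continuous_uncurry.comp (hs.prodMk ha)

/-- The automorphism `α g` as a continuous linear map. -/
def toCLM (g : G) : A →L[ℂ] A :=
  LinearMap.mkContinuous
    { toFun := α g, map_add' := map_add (α g), map_smul' := map_smul (α g) } 1
    (fun a => by simpa using (α.norm_apply g a).le)

theorem toCLM_apply (g : G) (a : A) : α.toCLM g a = α g a := rfl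

end CStarAction

/-- A (possibly neither Hausdorff nor complete) normed ⋆-algebra whose seminorm satisfies the
C⋆-identity. -/
class PreCStarAlgebra (E : Type*) extends NonUnitalSeminormedRing E, StarRing E,
    NormedSpace ℂ E, IsScalarTower ℂ E E, SMulCommClass ℂ E E, StarModule ℂ E where
  norm_mul_self_le : ∀ x : E, ‖x‖ * ‖x‖ ≤ ‖star x * x‖

theorem PreCStarAlgebra.norm_star_le {E : Type*} [PreCStarAlgebra E] (x : E) :
    ‖star x‖ ≤ ‖x‖ := by
  rcases (norm_nonneg (star x)).eq_or_lt with h | h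
  · rw [← h]; exact norm_nonneg x
  · have h1 := (norm_mul_self_le (star x)).trans (norm_mul_le _ _)
    rw [star_star] at h1
    exact le_of_mul_le_mul_right h1 h

/-- The C⋆-algebra obtained by (Hausdorff) completion. -/
def CStarCompletion (E : Type u) [PreCStarAlgebra E] : Type u := UniformSpace.Completion E

namespace CStarCompletion

variable (E : Type u) [PreCStarAlgebra E]

open UniformSpace UniformSpace.Completion

instance : NormedAddCommGroup (CStarCompletion E) :=
  inferInstanceAs (NormedAddCommGroup (Completion (E)))
instance : NormedSpace ℂ (CStarCompletion E) :=
  inferInstanceAs (NormedSpace ℂ (Completion (E)))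
instance : CompleteSpace (CStarCompletion E) :=
  inferInstanceAs (CompleteSpace (Completion (E)))

variable {E}

/-- The canonical map from the algebra to its completion. -/
def incl (f : E) : CStarCompletion E := ((f : Completion (E)))

theorem norm_incl (f : E) : ‖incl f‖ = ‖f‖ := Completion.norm_coe f
theorem incl_add (f g : E) : incl (f + g) = incl f + incl g := Completion.coe_add f g
theorem incl_zero : incl (0 : E) = 0 := rfl
theorem incl_smul (c : ℂ) (f : E) : incl (c • f) = c • incl f := Completion.coe_smul c f
theorem incl_sub (f g : E) : incl (f - g) = incl f - incl g := Completion.coe_sub f g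
theorem continuous_incl : Continuous (incl : E → CStarCompletion E) :=
  Completion.continuous_coe _
theorem isDenseInducing_incl : IsDenseInducing (incl : E → CStarCompletion E) :=
  Completion.isDenseInducing_coe

theorem induction_on {p : CStarCompletion E → Prop} (a : CStarCompletion E)
    (hp : IsClosed {a | p a}) (ih : ∀ f : E, p (incl f)) : p a :=
  Completion.induction_on a hp ih

/-- The multiplication extends the product by continuity. -/
instance : Mul (CStarCompletion E) where
  mul a b := (isDenseInducing_incl.prodMap isDenseInducing_incl).extend
    (fun p : E × E => incl (p.1 * p.2)) (a, b)

theorem incl_mul (f g : E) : incl (f * g) = incl f * incl g :=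
  ((isDenseInducing_incl.prodMap isDenseInducing_incl).extend_eq
    (f := fun p : E × E => incl (p.1 * p.2))
    (continuous_incl.comp continuous_mul) (f, g)).symm

instance : ContinuousMul (CStarCompletion E) where
  continuous_mul := by
    let i : E →+ CStarCompletion E := ⟨⟨incl, incl_zero⟩, incl_add⟩
    let m := (AddMonoidHom.mul : E →+ E →+ E).compr₂ i
    have : Continuous fun p : E × E => m p.1 p.2 :=
      continuous_incl.comp continuous_mul
    have di : IsDenseInducing i := isDenseInducing_incl
    exact (di.extend_Z_bilin di this :)

/-- The involution extends the involution of the algebra by continuity. -/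
instance : Star (CStarCompletion E) where
  star := Completion.map (star : E → E)

theorem uniformContinuous_convStar :
    UniformContinuous (star : E → E) :=
  haveI : NormedStarGroup E := ⟨PreCStarAlgebra.norm_star_le⟩
  (star_isometry (E := E)).uniformContinuous

theorem incl_star (f : E) : incl (star f) = star (incl f) :=
  (Completion.map_coe uniformContinuous_convStar f).symm

instance : ContinuousStar (CStarCompletion E) where
  continuous_star := Completion.continuous_map

theorem cp_mul_assoc (a b c : CStarCompletion E) : a * b * c = a * (b * c) := by
  induction a using induction_on with
  | hp => exact isClosed_eq
            (Continuous.mul (Continuous.mul continuous_id continuous_const) continuous_const)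
            (Continuous.mul continuous_id continuous_const)
  | ih a =>
  induction b using induction_on with
  | hp => exact isClosed_eq
            (Continuous.mul (Continuous.mul continuous_const continuous_id) continuous_const)
            (Continuous.mul continuous_const (Continuous.mul continuous_id continuous_const))
  | ih b =>
  induction c using induction_on with
  | hp => exact isClosed_eq
            (Continuous.mul continuous_const continuous_id)
            (Continuous.mul continuous_const (Continuous.mul continuous_const continuous_id))
  | ih c =>
  simp only [← incl_mul, mul_assoc]

theorem cp_mul_add (a b c : CStarCompletion E) : a * (b + c) = a * b + a * c := by
  induction a using induction_on with
  | hp => exact isClosed_eq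
            (Continuous.mul continuous_id continuous_const)
            (Continuous.add (Continuous.mul continuous_id continuous_const) (Continuous.mul continuous_id continuous_const))
  | ih a =>
  induction b using induction_on with
  | hp => exact isClosed_eq
            (Continuous.mul continuous_const (Continuous.add continuous_id continuous_const))
            (Continuous.add (Continuous.mul continuous_const continuous_id) continuous_const)
  | ih b =>
  induction c using induction_on with
  | hp => exact isClosed_eq
            (Continuous.mul continuous_const (Continuous.add continuous_const continuous_id))
            (Continuous.add continuous_const (Continuous.mul continuous_const continuous_id))
  | ih c =>
  simp only [← incl_mul, ← incl_add, mul_add]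

theorem cp_add_mul (a b c : CStarCompletion E) : (a + b) * c = a * c + b * c := by
  induction a using induction_on with
  | hp => exact isClosed_eq
            (Continuous.mul (Continuous.add continuous_id continuous_const) continuous_const)
            (Continuous.add (Continuous.mul continuous_id continuous_const) continuous_const)
  | ih a =>
  induction b using induction_on with
  | hp => exact isClosed_eq
            (Continuous.mul (Continuous.add continuous_const continuous_id) continuous_const)
            (Continuous.add continuous_const (Continuous.mul continuous_id continuous_const))
  | ih b =>
  induction c using induction_on with
  | hp => exact isClosed_eq
            (Continuous.mul continuous_const continuous_id)
            (Continuous.add (Continuous.mul continuous_const continuous_id) (Continuous.mul continuous_const continuous_id))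
  | ih c =>
  simp only [← incl_mul, ← incl_add, add_mul]

theorem cp_zero_mul (a : CStarCompletion E) : 0 * a = 0 := by
  induction a using induction_on with
  | hp => exact isClosed_eq
            (Continuous.mul continuous_const continuous_id)
            (continuous_const)
  | ih a =>
  rw [← incl_zero, ← incl_mul, zero_mul]

theorem cp_mul_zero (a : CStarCompletion E) : a * 0 = 0 := by
  induction a using induction_on with
  | hp => exact isClosed_eq
            (Continuous.mul continuous_id continuous_const)
            (continuous_const)
  | ih a =>
  rw [← incl_zero, ← incl_mul, mul_zero]

theorem cp_norm_mul_le (a b : CStarCompletion E) : ‖a * b‖ ≤ ‖a‖ * ‖b‖ := by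
  induction a using induction_on with
  | hp => exact isClosed_le
            (Continuous.norm (Continuous.mul continuous_id continuous_const))
            (Continuous.mul (Continuous.norm continuous_id) continuous_const)
  | ih a =>
  induction b using induction_on with
  | hp => exact isClosed_le
            (Continuous.norm (Continuous.mul continuous_const continuous_id))
            (Continuous.mul continuous_const (Continuous.norm continuous_id))
  | ih b =>
  simpa only [← incl_mul, norm_incl] using norm_mul_le a b

theorem cp_star_star (a : CStarCompletion E) : star (star a) = a := by
  induction a using induction_on with
  | hp => exact isClosed_eq
            (Continuous.star (Continuous.star continuous_id))
            (continuous_id)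
  | ih a =>
  simp only [← incl_star, star_star]

theorem cp_star_mul (a b : CStarCompletion E) : star (a * b) = star b * star a := by
  induction a using induction_on with
  | hp => exact isClosed_eq
            (Continuous.star (Continuous.mul continuous_id continuous_const))
            (Continuous.mul continuous_const (Continuous.star continuous_id))
  | ih a =>
  induction b using induction_on with
  | hp => exact isClosed_eq
            (Continuous.star (Continuous.mul continuous_const continuous_id))
            (Continuous.mul (Continuous.star continuous_id) continuous_const)
  | ih b =>
  simp only [← incl_mul, ← incl_star, star_mul]

theorem cp_star_add (a b : CStarCompletion E) : star (a + b) = star a + star b := by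
  induction a using induction_on with
  | hp => exact isClosed_eq
            (Continuous.star (Continuous.add continuous_id continuous_const))
            (Continuous.add (Continuous.star continuous_id) continuous_const)
  | ih a =>
  induction b using induction_on with
  | hp => exact isClosed_eq
            (Continuous.star (Continuous.add continuous_const continuous_id))
            (Continuous.add continuous_const (Continuous.star continuous_id))
  | ih b =>
  simp only [← incl_add, ← incl_star, star_add]

theorem cp_norm_sq_le (a : CStarCompletion E) : ‖a‖ * ‖a‖ ≤ ‖star a * a‖ := by
  induction a using induction_on with
  | hp => exact isClosed_le
            (Continuous.mul (Continuous.norm continuous_id) (Continuous.norm continuous_id))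
            (Continuous.norm (Continuous.mul (Continuous.star continuous_id) continuous_id))
  | ih a =>
  simpa only [← incl_mul, ← incl_star, norm_incl] using PreCStarAlgebra.norm_mul_self_le a

theorem cp_smul_mul (c : ℂ) (a b : CStarCompletion E) : c • a * b = c • (a * b) := by
  induction a using induction_on with
  | hp => exact isClosed_eq
            (Continuous.mul (Continuous.const_smul continuous_id c) continuous_const)
            (Continuous.const_smul (Continuous.mul continuous_id continuous_const) c)
  | ih a =>
  induction b using induction_on with
  | hp => exact isClosed_eq
            (Continuous.mul continuous_const continuous_id)
            (Continuous.const_smul (Continuous.mul continuous_const continuous_id) c)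
  | ih b =>
  simp only [← incl_mul, ← incl_smul, smul_mul_assoc]

theorem cp_mul_smul (c : ℂ) (a b : CStarCompletion E) : a * c • b = c • (a * b) := by
  induction a using induction_on with
  | hp => exact isClosed_eq
            (Continuous.mul continuous_id continuous_const)
            (Continuous.const_smul (Continuous.mul continuous_id continuous_const) c)
  | ih a =>
  induction b using induction_on with
  | hp => exact isClosed_eq
            (Continuous.mul continuous_const (Continuous.const_smul continuous_id c))
            (Continuous.const_smul (Continuous.mul continuous_const continuous_id) c)
  | ih b =>
  simp only [← incl_mul, ← incl_smul, mul_smul_comm]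

theorem cp_star_smul (c : ℂ) (a : CStarCompletion E) : star (c • a) = star c • star a := by
  induction a using induction_on with
  | hp => exact isClosed_eq
            (Continuous.star (Continuous.const_smul continuous_id c))
            (Continuous.const_smul (Continuous.star continuous_id) (star c))
  | ih a =>
  simp only [← incl_star, ← incl_smul, star_smul]

instance : NonUnitalRing (CStarCompletion E) where
  mul_assoc := cp_mul_assoc
  left_distrib := cp_mul_add
  right_distrib := cp_add_mul
  zero_mul := cp_zero_mul
  mul_zero := cp_mul_zero

/-- The completion is a C⋆-algebra. -/
instance : NonUnitalCStarAlgebra (CStarCompletion E) where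
  __ := (inferInstance : NormedAddCommGroup (CStarCompletion E))
  __ := (inferInstance : NonUnitalRing (CStarCompletion E))
  __ := (inferInstance : NormedSpace ℂ (CStarCompletion E))
  __ := (inferInstance : CompleteSpace (CStarCompletion E))
  norm_mul_le := cp_norm_mul_le
  star_involutive := cp_star_star
  star_mul := cp_star_mul
  star_add := cp_star_add
  norm_mul_self_le := cp_norm_sq_le
  smul_assoc := cp_smul_mul
  smul_comm c a b := (cp_mul_smul c a b).symm
  star_smul := cp_star_smul

end CStarCompletion

/-- The space `C_c(G, A)`, to be equipped with the twisted convolution product and involution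
determined by the action `α` and the measure `μ`. -/
def ConvAlg {G : Type u} {A : Type v} [Group G] [TopologicalSpace G] [NonUnitalCStarAlgebra A]
    [MeasurableSpace G] (_α : CStarAction G A) (_μ : Measure G) : Type (max u v) :=
  C_c(G, A)

namespace ConvAlg

section Linear

variable {G : Type u} {A : Type v} [Group G] [TopologicalSpace G] [NonUnitalCStarAlgebra A]
  [MeasurableSpace G] (α : CStarAction G A) (μ : Measure G)

instance : AddCommGroup (ConvAlg α μ) := inferInstanceAs (AddCommGroup C_c(G, A))
instance : Module ℂ (ConvAlg α μ) := inferInstanceAs (Module ℂ C_c(G, A))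
instance : FunLike (ConvAlg α μ) G A := inferInstanceAs (FunLike C_c(G, A) G A)

variable {α μ}

/-- A compactly supported continuous function, as an element of the convolution algebra. -/
def of (f : C_c(G, A)) : ConvAlg α μ := f

@[simp] theorem of_apply (f : C_c(G, A)) (s : G) : (of f : ConvAlg α μ) s = f s := rfl

@[ext] theorem ext {f g : ConvAlg α μ} (h : ∀ s, f s = g s) : f = g := DFunLike.ext _ _ h

@[simp] theorem add_apply (f g : ConvAlg α μ) (s : G) : (f + g) s = f s + g s := rfl
@[simp] theorem sub_apply (f g : ConvAlg α μ) (s : G) : (f - g) s = f s - g s := rfl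
@[simp] theorem zero_apply (s : G) : (0 : ConvAlg α μ) s = 0 := rfl
@[simp] theorem smul_apply (c : ℂ) (f : ConvAlg α μ) (s : G) : (c • f) s = c • f s := rfl

theorem continuous (f : ConvAlg α μ) : Continuous f :=
  map_continuous (F := C_c(G, A)) f

theorem hasCompactSupport (f : ConvAlg α μ) : HasCompactSupport f :=
  CompactlySupportedContinuousMap.hasCompactSupport (β := A) f

/-- The `L¹`-norm `∫ ‖f s‖ dμ(s)`. -/
def l1norm (f : ConvAlg α μ) : ℝ := ∫ s, ‖f s‖ ∂μ

end Linear

variable {G : Type u} {A : Type v} [CommGroup G] [TopologicalSpace G] [IsTopologicalGroup G]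
  [MeasurableSpace G] [BorelSpace G] [NonUnitalCStarAlgebra A]
  {α : CStarAction G A} {μ : Measure G} [μ.IsHaarMeasure]

theorem conv_continuous₂ (f g : ConvAlg α μ) :
    Continuous fun p : G × G => f p.2 * α p.2 (g (p.2⁻¹ * p.1)) := by
  have hf := f.continuous
  have hg := g.continuous
  exact (hf.comp continuous_snd).mul
    (α.continuous_comp continuous_snd (hg.comp (by fun_prop)))

theorem conv_continuous (f g : ConvAlg α μ) :
    Continuous fun s => ∫ r, f r * α r (g (r⁻¹ * s)) ∂μ := by
  rw [← continuousOn_univ]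
  refine continuousOn_integral_of_compact_support (k := tsupport f) f.hasCompactSupport
    ((conv_continuous₂ f g).continuousOn) ?_
  intro s r _ hr
  rw [image_eq_zero_of_notMem_tsupport hr, zero_mul]

theorem conv_hasCompactSupport (f g : ConvAlg α μ) :
    HasCompactSupport fun s => ∫ r, f r * α r (g (r⁻¹ * s)) ∂μ := by
  refine HasCompactSupport.intro
    (IsCompact.mul f.hasCompactSupport g.hasCompactSupport) (fun s hs => ?_)
  refine (integral_congr_ae (Filter.Eventually.of_forall fun r => ?_)).trans (integral_zero G A)
  by_cases hr : r ∈ tsupport f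
  · have : r⁻¹ * s ∉ tsupport g := fun h => hs ⟨r, hr, r⁻¹ * s, h, by simp⟩
    simp [image_eq_zero_of_notMem_tsupport this]
  · simp [image_eq_zero_of_notMem_tsupport hr]

theorem conv_integrable (f g : ConvAlg α μ) (s : G) :
    Integrable (fun r => f r * α r (g (r⁻¹ * s))) μ := by
  refine Continuous.integrable_of_hasCompactSupport
    ((conv_continuous₂ f g).comp (Continuous.prodMk_right s)) ?_
  exact HasCompactSupport.intro f.hasCompactSupport fun r hr => by
    simp [image_eq_zero_of_notMem_tsupport hr]

/-- The convolution product `(f * g)(s) = ∫ f(r) α_r(g(r⁻¹ s)) dμ(r)`. -/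
instance : Mul (ConvAlg α μ) where
  mul f g := of ⟨⟨fun s => ∫ r, f r * α r (g (r⁻¹ * s)) ∂μ, conv_continuous f g⟩,
    conv_hasCompactSupport f g⟩

theorem mul_apply (f g : ConvAlg α μ) (s : G) :
    (f * g) s = ∫ r, f r * α r (g (r⁻¹ * s)) ∂μ := rfl

/-- The involution `f⋆(s) = α_s(f(s⁻¹)⋆)`; abelian groups are unimodular, so that there is no
modular function. -/
instance : Star (ConvAlg α μ) where
  star f := of ⟨⟨fun s => α s (star (f s⁻¹)), by
      have hf := f.continuous
      exact α.continuous_comp continuous_id (by fun_prop)⟩, by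
    refine HasCompactSupport.intro (IsCompact.inv f.hasCompactSupport) (fun s hs => ?_)
    have : s⁻¹ ∉ tsupport f := by simpa using hs
    simp [image_eq_zero_of_notMem_tsupport this]⟩

theorem star_apply (f : ConvAlg α μ) (s : G) : (star f) s = α s (star (f s⁻¹)) := rfl

theorem conv_assoc (f g k : ConvAlg α μ) : f * g * k = f * (g * k) := by
  ext s
  have h1 : ∀ r, (f * g) r * α r (k (r⁻¹ * s))
      = ∫ t, f t * α t (g (t⁻¹ * r)) * α r (k (r⁻¹ * s)) ∂μ := fun r =>
    (((ContinuousLinearMap.mul ℂ A).flip (α r (k (r⁻¹ * s)))).integral_comp_comm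
      (conv_integrable f g r)).symm
  have h2 : ∀ t, f t * α t ((g * k) (t⁻¹ * s))
      = ∫ r, f t * α t (g (t⁻¹ * r)) * α r (k (r⁻¹ * s)) ∂μ := fun t => by
    have := ((ContinuousLinearMap.mul ℂ A (f t)).comp (α.toCLM t)).integral_comp_comm
      (conv_integrable g k (t⁻¹ * s))
    rw [← integral_mul_left_eq_self _ t⁻¹] at this
    refine this.symm.trans ?_
    congr 1
    ext r
    simp only [ContinuousLinearMap.comp_apply, CStarAction.toCLM_apply,
      ContinuousLinearMap.mul_apply', map_mul (α t), mul_assoc]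
    rw [← α.mul_apply]
    simp
  rw [mul_apply, mul_apply]
  simp only [h1, h2]
  refine integral_integral_swap_of_hasCompactSupport (f := fun r t =>
    f t * α t (g (t⁻¹ * r)) * α r (k (r⁻¹ * s))) ?_ ?_
  · have hf := f.continuous
    have hg := g.continuous
    have hk := k.continuous
    exact ((hf.comp continuous_snd).mul
      (α.continuous_comp continuous_snd (hg.comp (by fun_prop)))).mul
      (α.continuous_comp continuous_fst (hk.comp (by fun_prop)))
  · refine HasCompactSupport.intro
      ((IsCompact.mul f.hasCompactSupport g.hasCompactSupport).prod f.hasCompactSupport) ?_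
    rintro ⟨r, t⟩ hrt
    by_cases ht : t ∈ tsupport f
    · have : t⁻¹ * r ∉ tsupport g := fun h => hrt ⟨⟨t, ht, t⁻¹ * r, h, by simp⟩, ht⟩
      simp [Function.uncurry, image_eq_zero_of_notMem_tsupport this]
    · simp [Function.uncurry, image_eq_zero_of_notMem_tsupport ht]

instance : NonUnitalRing (ConvAlg α μ) where
  mul_assoc := conv_assoc
  left_distrib f g k := by
    ext s
    simp only [mul_apply, add_apply, map_add, mul_add]
    exact integral_add (conv_integrable f g s) (conv_integrable f k s)
  right_distrib f g k := by
    ext s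
    simp only [mul_apply, add_apply, add_mul]
    exact integral_add (conv_integrable f k s) (conv_integrable g k s)
  zero_mul f := by ext s; simp [mul_apply]
  mul_zero f := by ext s; simp [mul_apply]

instance : IsScalarTower ℂ (ConvAlg α μ) (ConvAlg α μ) where
  smul_assoc c f g := by
    ext s
    simp only [smul_eq_mul, mul_apply, smul_apply, smul_mul_assoc]
    exact integral_smul c _

instance : SMulCommClass ℂ (ConvAlg α μ) (ConvAlg α μ) where
  smul_comm c f g := by
    ext s
    simp only [smul_eq_mul, mul_apply, smul_apply, map_smul, mul_smul_comm]
    exact (integral_smul c _).symm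

theorem apply_star_integral (s : G) {f : G → A} (hf : Integrable f μ) :
    α s (star (∫ r, f r ∂μ)) = ∫ r, α s (star (f r)) ∂μ :=
  ((((α.toCLM s).restrictScalars ℝ).comp
    ((starL' ℝ : A ≃L[ℝ] A) : A →L[ℝ] A)).integral_comp_comm hf).symm

instance : StarRing (ConvAlg α μ) where
  star_involutive f := by
    ext s
    simp only [star_apply, ← map_star, star_star, inv_inv]
    rw [← α.mul_apply]
    simp
  star_add f g := by ext s; simp [star_apply]
  star_mul f g := by
    ext s
    rw [star_apply, mul_apply, mul_apply, apply_star_integral s (conv_integrable f g s⁻¹)]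
    rw [← integral_mul_left_eq_self _ s⁻¹]
    congr 1
    ext r
    simp only [star_apply, star_mul, map_mul (α s), mul_inv_rev, inv_inv, ← map_star,
      ← α.mul_apply, mul_inv_cancel_left, mul_inv_cancel_right]

instance : StarModule ℂ (ConvAlg α μ) where
  star_smul c f := by ext s; simp [star_apply]

end ConvAlg

section Universal

variable {G : Type u} {A : Type v} [CommGroup G] [TopologicalSpace G] [IsTopologicalGroup G]
  [MeasurableSpace G] [BorelSpace G] [NonUnitalCStarAlgebra A]
  (α : CStarAction G A) (μ : Measure G) [μ.IsHaarMeasure]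

/-- A nondegenerate ⋆-representation of `C_c(G, A)` on a Hilbert space which is contractive for the
`L¹`-norm, i.e. (the restriction to the dense subalgebra `C_c(G, A)` of) a nondegenerate
⋆-representation of the Banach ⋆-algebra `L¹(G, A)`. -/
structure L1Rep (K : Type*) [NormedAddCommGroup K] [InnerProductSpace ℂ K] [CompleteSpace K] where
  toHom : ConvAlg α μ →⋆ₙₐ[ℂ] (K →L[ℂ] K)
  norm_le : ∀ f, ‖toHom f‖ ≤ f.l1norm
  nondegenerate : (Submodule.span ℂ {y : K | ∃ f x, toHom f x = y}).topologicalClosure = ⊤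

namespace ConvAlg

variable {α μ}

/-- The norms `‖π(f)‖`, where `π` runs through the nondegenerate representations of `L¹(G, A)`. -/
def repNorms (f : ConvAlg α μ) : Set ℝ :=
  {r | ∃ (K : Type (max u v)) (_ : NormedAddCommGroup K) (_ : InnerProductSpace ℂ K)
    (_ : CompleteSpace K) (π : L1Rep α μ K), ‖π.toHom f‖ = r}

theorem repNorms_bddAbove (f : ConvAlg α μ) : BddAbove f.repNorms := by
  refine ⟨f.l1norm, ?_⟩
  rintro r ⟨K, _, _, _, π, rfl⟩
  exact π.norm_le f

/-- The universal norm `sup ‖π(f)‖`, where `π` runs through the nondegenerate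
representations of `L¹(G, A)`. -/
def univNorm (f : ConvAlg α μ) : ℝ := sSup f.repNorms

theorem rep_le_univNorm (f : ConvAlg α μ) {K : Type (max u v)} [NormedAddCommGroup K]
    [InnerProductSpace ℂ K] [CompleteSpace K] (π : L1Rep α μ K) : ‖π.toHom f‖ ≤ f.univNorm :=
  le_csSup f.repNorms_bddAbove ⟨K, _, _, _, π, rfl⟩

theorem univNorm_nonneg (f : ConvAlg α μ) : 0 ≤ f.univNorm :=
  Real.sSup_nonneg (by rintro r ⟨K, _, _, _, π, rfl⟩; exact norm_nonneg _)

theorem l1norm_nonneg (f : ConvAlg α μ) : 0 ≤ f.l1norm :=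
  integral_nonneg fun _ => norm_nonneg _

theorem univNorm_le_of_rep {f : ConvAlg α μ} {c : ℝ} (hc : 0 ≤ c)
    (h : ∀ (K : Type (max u v)) [NormedAddCommGroup K] [InnerProductSpace ℂ K]
      [CompleteSpace K] (π : L1Rep α μ K), ‖π.toHom f‖ ≤ c) : f.univNorm ≤ c :=
  Real.sSup_le (by rintro r ⟨K, _, _, _, π, rfl⟩; exact h K π) hc

theorem univNorm_le_l1norm (f : ConvAlg α μ) : f.univNorm ≤ f.l1norm :=
  univNorm_le_of_rep f.l1norm_nonneg fun _ _ _ _ π => π.norm_le f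

theorem univNorm_zero : (0 : ConvAlg α μ).univNorm = 0 :=
  le_antisymm (univNorm_le_of_rep le_rfl fun _ _ _ _ π => by simp) (univNorm_nonneg _)

theorem univNorm_add_le (f g : ConvAlg α μ) : (f + g).univNorm ≤ f.univNorm + g.univNorm :=
  univNorm_le_of_rep (add_nonneg f.univNorm_nonneg g.univNorm_nonneg) fun _ _ _ _ π => by
    rw [map_add]
    exact (norm_add_le _ _).trans (add_le_add (rep_le_univNorm f π) (rep_le_univNorm g π))

theorem univNorm_neg (f : ConvAlg α μ) : (-f).univNorm = f.univNorm := by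
  simp [univNorm, repNorms]

theorem univNorm_smul_le (c : ℂ) (f : ConvAlg α μ) : (c • f).univNorm ≤ ‖c‖ * f.univNorm :=
  univNorm_le_of_rep (mul_nonneg (norm_nonneg c) f.univNorm_nonneg) fun _ _ _ _ π => by
    rw [map_smul, norm_smul]
    exact mul_le_mul_of_nonneg_left (rep_le_univNorm f π) (norm_nonneg c)

theorem univNorm_mul_le (f g : ConvAlg α μ) : (f * g).univNorm ≤ f.univNorm * g.univNorm :=
  univNorm_le_of_rep (mul_nonneg f.univNorm_nonneg g.univNorm_nonneg) fun _ _ _ _ π => by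
    rw [map_mul]
    exact (norm_mul_le _ _).trans (mul_le_mul (rep_le_univNorm f π) (rep_le_univNorm g π)
      (norm_nonneg _) f.univNorm_nonneg)

theorem univNorm_sq_le (f : ConvAlg α μ) :
    f.univNorm * f.univNorm ≤ (star f * f).univNorm := by
  have h : f.univNorm ≤ Real.sqrt (star f * f).univNorm :=
    univNorm_le_of_rep (Real.sqrt_nonneg _) fun _ _ _ _ π => by
      apply Real.le_sqrt_of_sq_le
      rw [sq, ← CStarRing.norm_star_mul_self, ← map_star, ← map_mul]
      exact rep_le_univNorm _ π
  calc f.univNorm * f.univNorm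
      ≤ Real.sqrt (star f * f).univNorm * Real.sqrt (star f * f).univNorm :=
        mul_self_le_mul_self f.univNorm_nonneg h
    _ = _ := Real.mul_self_sqrt (univNorm_nonneg _)

/-- `C_c(G, A)` with the universal norm. -/
instance : PreCStarAlgebra (ConvAlg α μ) where
  __ := (inferInstance : NonUnitalRing (ConvAlg α μ))
  __ := (inferInstance : Module ℂ (ConvAlg α μ))
  __ := (inferInstance : StarRing (ConvAlg α μ))
  __ := AddGroupSeminorm.toSeminormedAddCommGroup (E := ConvAlg α μ)
    { toFun := univNorm, map_zero' := univNorm_zero, add_le' := univNorm_add_le,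
      neg' := univNorm_neg }
  norm_mul_le := univNorm_mul_le
  norm_smul_le := univNorm_smul_le
  smul_assoc c f g := smul_assoc c f g
  smul_comm c f g := smul_comm c f g
  star_smul c f := star_smul c f
  norm_mul_self_le := univNorm_sq_le

theorem norm_eq_univNorm (f : ConvAlg α μ) : ‖f‖ = f.univNorm := rfl

end ConvAlg

/-- The (full) crossed product `A ⋊_α G`: the (Hausdorff) completion of `C_c(G, A)` in the
universal norm. -/
abbrev CrossedProduct : Type (max u v) := CStarCompletion (ConvAlg α μ)


end Universal

section GroupAlgebra

variable {G : Type u} [CommGroup G] [TopologicalSpace G] [IsTopologicalGroup G]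
  [MeasurableSpace G] [BorelSpace G] (μ : Measure G) [μ.IsHaarMeasure]

/-- The group C⋆-algebra `C⋆(G)`: the crossed product of `ℂ` by the trivial action, i.e. the
enveloping C⋆-algebra of `L¹(G)`. -/
abbrev GroupCStar : Type u := CrossedProduct (CStarAction.trivial G ℂ) μ

/-- The canonical map `C_c(G) → C⋆(G)`. -/
def GroupCStar.of (f : C_c(G, ℂ)) : GroupCStar μ := CStarCompletion.incl (ConvAlg.of f)

end GroupAlgebra

section TwoVariables

variable {G H : Type u} [CommGroup G] [TopologicalSpace G] [IsTopologicalGroup G]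
  [MeasurableSpace G] [BorelSpace G] {μ : Measure G} [μ.IsHaarMeasure]
  [CommGroup H] [TopologicalSpace H] [IsTopologicalGroup H]
  [MeasurableSpace H] [BorelSpace H]

/-- The function `f(·, h)` of the first variable. -/
def sliceLeft (f : C_c(G × H, ℂ)) (h : H) : C_c(G, ℂ) :=
  ⟨⟨fun g => f (g, h), (map_continuous f).comp (Continuous.prodMk_left h)⟩, by
    refine HasCompactSupport.intro (f.hasCompactSupport.isCompact.image continuous_fst)
      (fun g hg => ?_)
    exact image_eq_zero_of_notMem_tsupport (f := f) fun hmem => hg ⟨(g, h), hmem, rfl⟩⟩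

theorem continuous_sliceLeft (f : C_c(G × H, ℂ)) :
    Continuous fun h => GroupCStar.of μ (sliceLeft f h) := by
  rw [continuous_iff_continuousAt]
  intro h₀
  rw [ContinuousAt, tendsto_iff_norm_sub_tendsto_zero]
  have hf : Continuous f := map_continuous f
  have hc : Continuous fun h => ∫ g, ‖f (g, h) - f (g, h₀)‖ ∂μ := by
    rw [← continuousOn_univ]
    refine continuousOn_integral_of_compact_support (k := Prod.fst '' tsupport f)
      (f.hasCompactSupport.isCompact.image continuous_fst) ?_ ?_
    · exact Continuous.continuousOn (by unfold Function.uncurry; fun_prop)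
    · intro h g _ hg
      have key : ∀ k, f (g, k) = 0 := fun k =>
        image_eq_zero_of_notMem_tsupport fun hmem => hg ⟨(g, k), hmem, rfl⟩
      simp [key]
  have h0 := hc.tendsto h₀
  simp only [sub_self, norm_zero, integral_zero] at h0
  refine squeeze_zero (fun _ => norm_nonneg _) (fun h => ?_) h0
  unfold GroupCStar.of
  rw [← CStarCompletion.incl_sub, CStarCompletion.norm_incl]
  exact ConvAlg.univNorm_le_l1norm _

/-- The canonical map `C_c(G × H) → C⋆(G) ⋊_δ H`, sending `f` to the class of
`h ↦ f(·, h) ∈ C_c(G) → C⋆(G)`. -/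
def CrossedProduct.ofProd (δ : CStarAction H (GroupCStar μ)) (ν : Measure H) [ν.IsHaarMeasure]
    (f : C_c(G × H, ℂ)) : CrossedProduct δ ν :=
  CStarCompletion.incl <| ConvAlg.of
    ⟨⟨fun h => GroupCStar.of μ (sliceLeft f h), continuous_sliceLeft f⟩, by
      refine HasCompactSupport.intro (f.hasCompactSupport.isCompact.image continuous_snd)
        (fun h hh => ?_)
      have : sliceLeft f h = 0 := by
        ext g
        exact image_eq_zero_of_notMem_tsupport (f := f) fun hmem => hh ⟨(g, h), hmem, rfl⟩
      change GroupCStar.of μ (sliceLeft f h) = 0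
      rw [this]
      rfl⟩

end TwoVariables

end

/-!
A nondegenerate representation of `C⋆(G) ⋊ H` amounts to a pair of unitary representations `U` of
`G` and `V` of `H` satisfying the Weyl relation `V_h U_g = β(h, g) U_g V_h`, where `β(h, g) = h(g)`,
and it maps `f ∈ C_c(G × H)` to `∫∫ f(g, h) U_g V_h dg dh`. Up to replacing `β` by
`(g, h) ↦ β(h, g⁻¹)`, the Weyl relation is symmetric in `G` and `H`, and rewriting `U_g V_h` as
`β(h, g⁻¹) V_h U_g` turns the integral for `f` into the integral for
`(h, g) ↦ β(h, g⁻¹) f(g, h)`. Hence both crossed products have the same representations on `C_c`,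
so that the twist is isometric for the universal norms; and since representations separate points,
its extension is multiplicative and ⋆-preserving.

The pairing `β` is jointly continuous, as the twist requires, because it can be read off from the
strongly continuous families `δ_h (λ_g a) = β(h, g) λ_g (δ_h a)` in `C⋆(G)`, where `λ` is the action
of `G` on `C⋆(G)` by translations.
-/

noncomputable section

namespace CStarCompletion

variable {E : Type u} [PreCStarAlgebra E]

theorem denseRange_incl : DenseRange (incl : E → CStarCompletion E) :=
  isDenseInducing_incl.dense

variable (E) in
/-- The canonical map to the completion, as a linear map. -/
def inclₗ : E →ₗ[ℂ] CStarCompletion E where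
  toFun := incl
  map_add' := incl_add
  map_smul' := incl_smul

@[simp] theorem inclₗ_apply (f : E) : inclₗ E f = incl f := rfl

variable {B : Type*} [NonUnitalCStarAlgebra B]

theorem extendOfNorm_incl {T : E →ₗ[ℂ] B} (hT : ∀ f, ‖T f‖ ≤ ‖f‖) (f : E) :
    T.extendOfNorm (inclₗ E) (incl f) = T f :=
  LinearMap.extendOfNorm_eq (e := inclₗ E) denseRange_incl
    ⟨1, fun x => by simpa [norm_incl] using hT x⟩ f

/-- The extension of a contractive ⋆-homomorphism to the completion. -/
def lift (T : E →⋆ₙₐ[ℂ] B) (hT : ∀ f, ‖T f‖ ≤ ‖f‖) : CStarCompletion E →⋆ₙₐ[ℂ] B :=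
  let L : CStarCompletion E →L[ℂ] B := (T : E →ₗ[ℂ] B).extendOfNorm (inclₗ E)
  have hL : ∀ f, L (incl f) = T f := extendOfNorm_incl hT
  { L with
    map_zero' := map_zero L
    map_mul' := fun a b => by
      induction a using induction_on with
      | hp => exact isClosed_eq (L.continuous.comp (continuous_id.mul continuous_const))
                (L.continuous.mul continuous_const)
      | ih a =>
      induction b using induction_on with
      | hp => exact isClosed_eq (L.continuous.comp (continuous_const.mul continuous_id))
                (continuous_const.mul L.continuous)
      | ih b =>
        refine (congrArg L (incl_mul a b)).symm.trans ?_
        rw [hL, map_mul]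
        exact congrArg₂ (· * ·) (hL a).symm (hL b).symm
    map_star' := fun a => by
      induction a using induction_on with
      | hp => exact isClosed_eq (L.continuous.comp continuous_star) L.continuous.star
      | ih a => exact (congrArg L (incl_star a)).symm.trans <| by simp [hL, map_star] }

@[simp] theorem lift_incl (T : E →⋆ₙₐ[ℂ] B) (hT : ∀ f, ‖T f‖ ≤ ‖f‖) (f : E) :
    lift T hT (incl f) = T f :=
  extendOfNorm_incl hT f

end CStarCompletion

section Determination

theorem continuous_of_eq_smul {Y X : Type*} [TopologicalSpace Y] [NormedAddCommGroup X]
    [NormedSpace ℂ X] {c : Y → ℂ} {v w : Y → X} (hv : Continuous v) (hw : Continuous w)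
    (h : ∀ y, v y = c y • w y) (hw₀ : ∀ y, w y ≠ 0) : Continuous c := by
  refine continuous_iff_continuousAt.2 fun y₀ => ?_
  obtain ⟨l, hl⟩ := SeparatingDual.exists_ne_zero (R := ℂ) (hw₀ y₀)
  have hlw : Continuous fun y => l (w y) := l.continuous.comp hw
  have hdiv : ContinuousAt (fun y => l (v y) / l (w y)) y₀ :=
    (l.continuous.comp hv).continuousAt.div hlw.continuousAt hl
  refine hdiv.congr ?_
  filter_upwards [hlw.continuousAt.eventually_ne hl] with y hy
  rw [h y, map_smul, smul_eq_mul, mul_div_cancel_right₀ _ hy]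

variable {Y : Type*} [TopologicalSpace Y] [R1Space Y] [LocallyCompactSpace Y]

theorem exists_nonneg_compactlySupported_eq_one (x : Y) : ∃ b : C_c(Y, ℝ), b x = 1 ∧ 0 ≤ ⇑b := by
  obtain ⟨b, hb1, -, hb, hb0⟩ := exists_continuous_one_zero_of_isCompact
    (isCompact_singleton (x := x)) isClosed_empty (Set.disjoint_empty _)
  exact ⟨⟨b, hb⟩, hb1 (Set.mem_singleton x), fun y => (hb0 y).1⟩

variable [MeasurableSpace Y] [OpensMeasurableSpace Y] {μ : Measure Y} [μ.IsOpenPosMeasure]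
  [IsFiniteMeasureOnCompacts μ]

theorem eq_zero_of_forall_integral_mul_eq_zero {k : Y → ℂ} (hk : Continuous k)
    (h : ∀ b : C_c(Y, ℂ), ∫ s, b s * k s ∂μ = 0) : k = 0 := by
  funext x
  by_contra hx
  obtain ⟨b, hb1, hb0⟩ := exists_nonneg_compactlySupported_eq_one x
  have hbc : Continuous b := map_continuous b
  have hpos : 0 < ∫ s, b s * ‖k s‖ ^ 2 ∂μ := by
    refine Continuous.integral_pos_of_hasCompactSupport_nonneg_nonzero (x := x) (by fun_prop)
      b.hasCompactSupport.mul_right (fun s => mul_nonneg (hb0 s) (sq_nonneg _)) ?_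
    simpa [hb1] using hx
  let c : C_c(Y, ℂ) := ⟨⟨fun s => (b s : ℂ) * star (k s), by fun_prop⟩,
    (b.hasCompactSupport.comp_left Complex.ofReal_zero).mul_right⟩
  have hck : ∀ s, c s * k s = ((b s * ‖k s‖ ^ 2 : ℝ) : ℂ) := fun s => by
    change (b s : ℂ) * star (k s) * k s = _
    rw [mul_assoc, mul_comm (star _), Complex.star_def, Complex.mul_conj']
    push_cast
    rfl
  have hzero := h c
  simp only [hck] at hzero
  rw [integral_complex_ofReal, Complex.ofReal_eq_zero] at hzero
  exact hpos.ne' hzero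

theorem eq_zero_of_forall_integral_smul_eq_zero {X : Type*} [NormedAddCommGroup X]
    [NormedSpace ℂ X] [CompleteSpace X] {k : Y → X} (hk : Continuous k)
    (h : ∀ b : C_c(Y, ℂ), ∫ s, b s • k s ∂μ = 0) : k = 0 := by
  funext x
  refine SeparatingDual.eq_zero_of_forall_dual_eq_zero (R := ℂ) fun l => ?_
  refine congrFun (eq_zero_of_forall_integral_mul_eq_zero (μ := μ) (l.continuous.comp hk)
    fun b => ?_) x
  have hint : Integrable (fun s => b s • k s) μ :=
    ((map_continuous b).smul hk).integrable_of_hasCompactSupport b.hasCompactSupport.smul_right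
  simpa [h b] using l.integral_comp_comm hint

end Determination

section Isometric

section Isometries

variable {S E : Type*} [TopologicalSpace S] [NormedAddCommGroup E] [NormedSpace ℂ E]

theorem lipschitzWith_one_of_norm_map {L : E →L[ℂ] E} (hL : ∀ x, ‖L x‖ = ‖x‖) :
    LipschitzWith 1 L :=
  (AddMonoidHomClass.isometry_of_norm L hL).lipschitz

theorem continuous_apply_of_dense {L : S → E →L[ℂ] E} (hL : ∀ s x, ‖L s x‖ = ‖x‖) {t : Set E}
    (ht : Dense t) (hc : ∀ x ∈ t, Continuous fun s => L s x) (x : E) :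
    Continuous fun s => L s x :=
  (continuous_prod_of_dense_continuous_lipschitzWith' (fun p : S × E => L p.1 p.2) 1 ht
    (fun s => lipschitzWith_one_of_norm_map (hL s)) hc).comp (Continuous.prodMk_left x)

end Isometries

/-- A strongly continuous representation of a group by linear isometries of a normed space. On a
Hilbert space this is the same thing as a strongly continuous unitary representation. -/
structure IsometricRep (S E : Type*) [Group S] [TopologicalSpace S] [NormedAddCommGroup E]
    [NormedSpace ℂ E] where
  toHom : S →* (E →L[ℂ] E)
  norm_map : ∀ s x, ‖toHom s x‖ = ‖x‖
  continuous_apply : ∀ x, Continuous fun s => toHom s x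

namespace IsometricRep

section Normed

variable {S E : Type*} [Group S] [TopologicalSpace S] [NormedAddCommGroup E] [NormedSpace ℂ E]

instance : CoeFun (IsometricRep S E) fun _ => S → E →L[ℂ] E := ⟨fun W => W.toHom⟩

variable (S E) in
/-- The trivial representation. -/
def trivial : IsometricRep S E where
  toHom := 1
  norm_map _ _ := rfl
  continuous_apply _ := continuous_const

@[simp] theorem trivial_apply (s : S) (x : E) : trivial S E s x = x := rfl

variable (W : IsometricRep S E)

theorem mul_apply (s t : S) (x : E) : W (s * t) x = W s (W t x) := by
  rw [map_mul]; rfl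

theorem one_apply (x : E) : W 1 x = x := by
  rw [map_one]; rfl

theorem continuous_comp {Y : Type*} [TopologicalSpace Y] {s : Y → S} {x : Y → E}
    (hs : Continuous s) (hx : Continuous x) : Continuous fun y => W (s y) (x y) :=
  (continuous_prod_of_continuous_lipschitzWith' (fun p : S × E => W p.1 p.2) 1
    (fun s => lipschitzWith_one_of_norm_map (W.norm_map s)) W.continuous_apply).comp (hs.prodMk hx)

end Normed

section Dense

variable {S E V : Type*} [Group S] [NormedAddCommGroup E] [NormedSpace ℂ E] [CompleteSpace E]
  [AddCommGroup V] [Module ℂ V] {e : V →ₗ[ℂ] E} {m : S →* Module.End ℂ V}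

theorem extendOfNorm_dense_apply (he : DenseRange e) (hm : ∀ s v, ‖e (m s v)‖ = ‖e v‖) (s : S)
    (v : V) : (e ∘ₗ m s).extendOfNorm e (e v) = e (m s v) :=
  LinearMap.extendOfNorm_eq he ⟨1, fun v => by simp [hm]⟩ v

theorem norm_extendOfNorm_dense (he : DenseRange e) (hm : ∀ s v, ‖e (m s v)‖ = ‖e v‖) (s : S)
    (x : E) : ‖(e ∘ₗ m s).extendOfNorm e x‖ = ‖x‖ := by
  induction x using he.induction_on with
  | hp => exact isClosed_eq (ContinuousLinearMap.continuous _).norm continuous_norm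
  | ih v => rw [extendOfNorm_dense_apply he hm, hm]

variable [TopologicalSpace S]

/-- The isometric representation on `E` extending an action by linear maps on a space with dense
range in `E`, provided the latter preserves the norm of `E` and has continuous orbits in `E`. -/
def ofDense (he : DenseRange e) (hm : ∀ s v, ‖e (m s v)‖ = ‖e v‖)
    (hc : ∀ v, Continuous fun s => e (m s v)) : IsometricRep S E where
  toHom :=
    { toFun := fun s => (e ∘ₗ m s).extendOfNorm e
      map_one' := by
        ext x
        induction x using he.induction_on with
        | hp => exact isClosed_eq (ContinuousLinearMap.continuous _) continuous_id
        | ih v => rw [extendOfNorm_dense_apply he hm, map_one]; rfl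
      map_mul' := fun s t => by
        ext x
        induction x using he.induction_on with
        | hp => exact isClosed_eq (ContinuousLinearMap.continuous _)
                  (ContinuousLinearMap.continuous _)
        | ih v =>
          change _ = (e ∘ₗ m s).extendOfNorm e ((e ∘ₗ m t).extendOfNorm e (e v))
          simp only [extendOfNorm_dense_apply he hm]
          rw [map_mul]; rfl }
  norm_map := norm_extendOfNorm_dense he hm
  continuous_apply := continuous_apply_of_dense (norm_extendOfNorm_dense he hm) he <| by
    rintro _ ⟨v, rfl⟩
    exact (hc v).congr fun s => (extendOfNorm_dense_apply he hm s v).symm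

@[simp] theorem ofDense_apply (he : DenseRange e) (hm : ∀ s v, ‖e (m s v)‖ = ‖e v‖)
    (hc : ∀ v, Continuous fun s => e (m s v)) (s : S) (v : V) :
    ofDense he hm hc s (e v) = e (m s v) :=
  extendOfNorm_dense_apply he hm s v

end Dense

section Hilbert

variable {S K : Type*} [Group S] [TopologicalSpace S] [NormedAddCommGroup K]
  [InnerProductSpace ℂ K] (W : IsometricRep S K)

theorem inner_map_map (s : S) (x y : K) : inner ℂ (W s x) (W s y) = inner ℂ x y :=
  LinearIsometry.inner_map_map (⟨(W s : K →ₗ[ℂ] K), W.norm_map s⟩ : K →ₗᵢ[ℂ] K) x y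

theorem inner_map_left (s : S) (x y : K) : inner ℂ (W s x) y = inner ℂ x (W s⁻¹ y) := by
  rw [← W.inner_map_map s x, ← W.mul_apply, mul_inv_cancel, W.one_apply]

end Hilbert

end IsometricRep

end Isometric

section ElementaryTensor

variable {G : Type u} {A : Type v} [Group G] [TopologicalSpace G] [MeasurableSpace G]
  [NonUnitalCStarAlgebra A] {α : CStarAction G A} {μ : Measure G}

/-- The elementary tensor `b ⊗ a`, i.e. the function `s ↦ b(s) a`, for `b ∈ C_c(G)` and `a ∈ A`. -/
def ConvAlg.tensor (b : C_c(G, ℂ)) (a : A) : ConvAlg α μ :=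
  ConvAlg.of ⟨⟨fun s => b s • a, (map_continuous b).smul continuous_const⟩,
    b.hasCompactSupport.smul_right⟩

@[simp] theorem ConvAlg.tensor_apply (b : C_c(G, ℂ)) (a : A) (s : G) :
    (ConvAlg.tensor b a : ConvAlg α μ) s = b s • a := rfl

theorem ConvAlg.integrable [IsTopologicalGroup G] [BorelSpace G] [IsFiniteMeasureOnCompacts μ]
    (f : ConvAlg α μ) : Integrable f μ :=
  f.continuous.integrable_of_hasCompactSupport f.hasCompactSupport

end ElementaryTensor

section Covariant

open scoped CStarAlgebra

theorem topologicalClosure_span_eq_top_iff {K : Type*} [NormedAddCommGroup K]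
    [InnerProductSpace ℂ K] [CompleteSpace K] {S : Set K} :
    (Submodule.span ℂ S).topologicalClosure = ⊤ ↔ ∀ y, (∀ z ∈ S, inner ℂ y z = 0) → y = 0 := by
  rw [Submodule.topologicalClosure_eq_top_iff, Submodule.eq_bot_iff]
  refine forall_congr' fun y => imp_congr_left ?_
  rw [Submodule.mem_orthogonal']
  refine ⟨fun h z hz => h z (Submodule.subset_span hz), fun h z hz => ?_⟩
  have hle : Submodule.span ℂ S ≤ (ℂ ∙ y)ᗮ := Submodule.span_le.2 fun w hw =>
    Submodule.mem_orthogonal_singleton_iff_inner_right.2 (h w hw)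
  exact Submodule.mem_orthogonal_singleton_iff_inner_right.1 (hle hz)

theorem inner_integral_left {Y K : Type*} [MeasurableSpace Y] {ρ : Measure Y}
    [NormedAddCommGroup K] [InnerProductSpace ℂ K] [CompleteSpace K] {a : Y → K}
    (ha : Integrable a ρ) (y : K) : inner ℂ (∫ s, a s ∂ρ) y = ∫ s, inner ℂ (a s) y ∂ρ := by
  rw [← inner_conj_symm, ← integral_inner ha y, ← integral_conj]
  simp only [inner_conj_symm]

/-- A nondegenerate covariant representation of an action on a C⋆-algebra. -/
structure CovariantRep {G A : Type*} [Group G] [TopologicalSpace G]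
    [NonUnitalCStarAlgebra A] (α : CStarAction G A) (K : Type*) [NormedAddCommGroup K]
    [InnerProductSpace ℂ K] [CompleteSpace K] where
  rep : A →⋆ₙₐ[ℂ] (K →L[ℂ] K)
  unitary : IsometricRep G K
  covariant : ∀ g a x, rep (α g a) (unitary g x) = unitary g (rep a x)
  nondegenerate : (Submodule.span ℂ {y : K | ∃ a x, rep a x = y}).topologicalClosure = ⊤

namespace CovariantRep

variable {G : Type u} {A : Type v} [CommGroup G] [TopologicalSpace G] [NonUnitalCStarAlgebra A]
  {α : CStarAction G A} {K : Type*} [NormedAddCommGroup K] [InnerProductSpace ℂ K]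
  [CompleteSpace K] (R : CovariantRep α K)

theorem norm_rep_apply_le (a : A) (x : K) : ‖R.rep a x‖ ≤ ‖a‖ * ‖x‖ :=
  ((R.rep a).le_opNorm x).trans
    (mul_le_mul_of_nonneg_right (NonUnitalStarAlgHom.norm_apply_le R.rep a) (norm_nonneg x))

theorem continuous_rep_comp {Y : Type*} [TopologicalSpace Y] {a : Y → A} {x : Y → K}
    (ha : Continuous a) (hx : Continuous x) : Continuous fun y => R.rep (a y) (x y) :=
  ((map_continuous R.rep).comp ha).clm_apply hx

theorem rep_integral_apply {Y : Type*} [MeasurableSpace Y] {ρ : Measure Y} {a : Y → A}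
    (ha : Integrable a ρ) (x : K) : R.rep (∫ y, a y ∂ρ) x = ∫ y, R.rep (a y) x ∂ρ :=
  (((ContinuousLinearMap.apply ℂ K x).comp
    (⟨R.rep, map_continuous R.rep⟩ : A →L[ℂ] K →L[ℂ] K)).integral_comp_comm ha).symm

variable [IsTopologicalGroup G] [MeasurableSpace G] [BorelSpace G] {μ : Measure G}

section FiniteOnCompacts

variable [IsFiniteMeasureOnCompacts μ]

theorem integrable_rep_unitary (f : ConvAlg α μ) (x : K) :
    Integrable (fun s => R.rep (f s) (R.unitary s x)) μ :=
  Continuous.integrable_of_hasCompactSupport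
    (R.continuous_rep_comp f.continuous (R.unitary.continuous_apply x))
    (HasCompactSupport.intro f.hasCompactSupport fun s hs => by
      simp [image_eq_zero_of_notMem_tsupport hs])

theorem norm_integral_rep_unitary_le (f : ConvAlg α μ) (x : K) :
    ‖∫ s, R.rep (f s) (R.unitary s x) ∂μ‖ ≤ f.l1norm * ‖x‖ := by
  refine (norm_integral_le_integral_norm _).trans ?_
  rw [ConvAlg.l1norm, ← integral_mul_const]
  refine integral_mono (R.integrable_rep_unitary f x).norm (f.integrable.norm.mul_const _)
    fun s => ?_
  refine (R.norm_rep_apply_le _ _).trans ?_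
  rw [R.unitary.norm_map]

/-- The value `∫ rep (f s) (unitary s) ds` at `f` of the integrated form of a covariant
representation. -/
def integratedOp (f : ConvAlg α μ) : K →L[ℂ] K :=
  LinearMap.mkContinuous
    { toFun x := ∫ s, R.rep (f s) (R.unitary s x) ∂μ
      map_add' x y := by
        simp only [map_add]
        exact integral_add (R.integrable_rep_unitary f x) (R.integrable_rep_unitary f y)
      map_smul' c x := by
        simp only [map_smul]
        exact integral_smul c _ } f.l1norm (R.norm_integral_rep_unitary_le f)

theorem integratedOp_apply (f : ConvAlg α μ) (x : K) :
    R.integratedOp f x = ∫ s, R.rep (f s) (R.unitary s x) ∂μ := rfl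

end FiniteOnCompacts

variable [μ.IsHaarMeasure]

theorem integral_swap_of_convolution (f g : ConvAlg α μ) (x : K) :
    ∫ s, ∫ r, R.rep (f r) (R.unitary r (R.rep (g (r⁻¹ * s)) (R.unitary (r⁻¹ * s) x))) ∂μ ∂μ =
      ∫ r, ∫ s, R.rep (f r) (R.unitary r (R.rep (g (r⁻¹ * s)) (R.unitary (r⁻¹ * s) x))) ∂μ ∂μ := by
  refine integral_integral_swap_of_hasCompactSupport ?_ ?_
  · exact R.continuous_rep_comp (f.continuous.comp continuous_snd)
      (R.unitary.continuous_comp continuous_snd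
        (R.continuous_rep_comp (g.continuous.comp (by fun_prop))
          (R.unitary.continuous_comp (by fun_prop) continuous_const)))
  · refine HasCompactSupport.intro
      ((f.hasCompactSupport.isCompact.mul g.hasCompactSupport).prod f.hasCompactSupport) ?_
    rintro ⟨s, r⟩ hsr
    by_cases hr : r ∈ tsupport f
    · have : r⁻¹ * s ∉ tsupport g := fun h => hsr ⟨⟨r, hr, r⁻¹ * s, h, by simp⟩, hr⟩
      simp [Function.uncurry, image_eq_zero_of_notMem_tsupport this]
    · simp [Function.uncurry, image_eq_zero_of_notMem_tsupport hr]

theorem integratedOp_mul (f g : ConvAlg α μ) :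
    R.integratedOp (f * g) = R.integratedOp f * R.integratedOp g := by
  ext x
  have hleft : ∀ s, R.rep ((f * g) s) (R.unitary s x)
      = ∫ r, R.rep (f r) (R.unitary r (R.rep (g (r⁻¹ * s)) (R.unitary (r⁻¹ * s) x))) ∂μ := by
    intro s
    rw [ConvAlg.mul_apply, R.rep_integral_apply (ConvAlg.conv_integrable f g s)]
    refine integral_congr_ae (.of_forall fun r => ?_)
    beta_reduce
    rw [← R.covariant, ← R.unitary.mul_apply, mul_inv_cancel_left]
    exact congrArg (fun T : K →L[ℂ] K => T (R.unitary s x)) (map_mul R.rep _ _)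
  have hright : ∀ r, R.rep (f r) (R.unitary r (R.integratedOp g x))
      = ∫ s, R.rep (f r) (R.unitary r (R.rep (g (r⁻¹ * s)) (R.unitary (r⁻¹ * s) x))) ∂μ := by
    intro r
    rw [integral_mul_left_eq_self (μ := μ)
      (fun s => R.rep (f r) (R.unitary r (R.rep (g s) (R.unitary s x)))) r⁻¹]
    exact (((R.rep (f r)).comp (R.unitary r)).integral_comp_comm
      (R.integrable_rep_unitary g x)).symm
  calc R.integratedOp (f * g) x
      = ∫ s, ∫ r, R.rep (f r)
          (R.unitary r (R.rep (g (r⁻¹ * s)) (R.unitary (r⁻¹ * s) x))) ∂μ ∂μ :=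
        integral_congr_ae (.of_forall hleft)
    _ = _ := R.integral_swap_of_convolution f g x
    _ = R.integratedOp f (R.integratedOp g x) :=
        (integral_congr_ae (.of_forall hright)).symm

theorem integratedOp_star [μ.IsInvInvariant] (f : ConvAlg α μ) :
    R.integratedOp (star f) = star (R.integratedOp f) := by
  rw [ContinuousLinearMap.star_eq_adjoint, ContinuousLinearMap.eq_adjoint_iff]
  intro x y
  rw [integratedOp_apply, integratedOp_apply,
    inner_integral_left (R.integrable_rep_unitary (star f) x),
    ← integral_inner (R.integrable_rep_unitary f y) x, ← integral_inv_eq_self _ μ]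
  refine integral_congr_ae (.of_forall fun s => ?_)
  change inner ℂ (R.rep (star f s⁻¹) (R.unitary s⁻¹ x)) y = inner ℂ x (R.rep (f s) (R.unitary s y))
  rw [ConvAlg.star_apply, inv_inv, R.covariant, R.unitary.inner_map_left, inv_inv, map_star,
    ContinuousLinearMap.star_eq_adjoint, ContinuousLinearMap.adjoint_inner_left]

theorem eq_zero_of_forall_inner_integratedOp_eq_zero [LocallyCompactSpace G] {y : K}
    (hy : ∀ (f : ConvAlg α μ) x, inner ℂ y (R.integratedOp f x) = 0) : y = 0 := by
  refine topologicalClosure_span_eq_top_iff.1 R.nondegenerate y ?_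
  rintro _ ⟨a, x, rfl⟩
  have hk : Continuous fun s => inner ℂ y (R.rep a (R.unitary s x)) :=
    continuous_const.inner (R.continuous_rep_comp continuous_const (R.unitary.continuous_apply x))
  have hzero := congrFun (eq_zero_of_forall_integral_mul_eq_zero (μ := μ) hk fun b => ?_) 1
  · simpa only [R.unitary.one_apply, Pi.zero_apply] using hzero
  · have hb := hy (ConvAlg.tensor b a) x
    rw [integratedOp_apply, ← integral_inner (R.integrable_rep_unitary _ x) y] at hb
    simpa only [ConvAlg.tensor_apply, map_smul, _root_.smul_apply, inner_smul_right] using hb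

variable (μ) in
/-- The integrated form of a covariant representation, as a nondegenerate representation of the
`L¹`-algebra. -/
def toL1Rep [LocallyCompactSpace G] [μ.IsInvInvariant] : L1Rep α μ K where
  toHom :=
    { toFun := R.integratedOp
      map_smul' c f := by
        ext x
        simp only [integratedOp_apply, ConvAlg.smul_apply, map_smul]
        exact integral_smul c _
      map_zero' := by ext x; simp [integratedOp_apply]
      map_add' f g := by
        ext x
        simp only [integratedOp_apply, ConvAlg.add_apply, map_add, add_apply]
        exact integral_add (R.integrable_rep_unitary f x) (R.integrable_rep_unitary g x)
      map_mul' := R.integratedOp_mul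
      map_star' := R.integratedOp_star }
  norm_le f :=
    (R.integratedOp f).opNorm_le_bound f.l1norm_nonneg (R.norm_integral_rep_unitary_le f)
  nondegenerate := topologicalClosure_span_eq_top_iff.2 fun _ hy =>
    R.eq_zero_of_forall_inner_integratedOp_eq_zero fun f x => hy _ ⟨f, x, rfl⟩

theorem toL1Rep_apply [LocallyCompactSpace G] [μ.IsInvInvariant] (f : ConvAlg α μ) (x : K) :
    (R.toL1Rep μ).toHom f x = ∫ s, R.rep (f s) (R.unitary s x) ∂μ := rfl

end CovariantRep

end Covariant

section ScalarCoefficients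

variable {K : Type*} [NormedAddCommGroup K] [InnerProductSpace ℂ K] [CompleteSpace K]

variable (K) in
/-- The representation of `ℂ` by scalars. -/
def scalarRep : ℂ →⋆ₙₐ[ℂ] (K →L[ℂ] K) where
  toFun c := c • 1
  map_smul' c d := by simp [mul_smul]
  map_zero' := zero_smul _ _
  map_add' := fun c d => add_smul c d _
  map_mul' c d := by simp [mul_smul, smul_comm c d]
  map_star' c := by simp [star_smul]

theorem scalarRep_apply (c : ℂ) (x : K) : scalarRep K c x = c • x := rfl

/-- A unitary representation, as a covariant representation of the trivial action on `ℂ`. -/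
def IsometricRep.toCovariantRep {G : Type*} [Group G] [TopologicalSpace G]
    (W : IsometricRep G K) : CovariantRep (CStarAction.trivial G ℂ) K where
  rep := scalarRep K
  unitary := W
  covariant g a x := by
    rw [scalarRep_apply, scalarRep_apply, map_smul]
    rfl
  nondegenerate := topologicalClosure_span_eq_top_iff.2 fun y hy =>
    inner_self_eq_zero.1 (hy y ⟨1, y, one_smul ℂ y⟩)

end ScalarCoefficients

section Extension

variable {G : Type u} {A : Type v} [CommGroup G] [TopologicalSpace G] [IsTopologicalGroup G]
  [MeasurableSpace G] [BorelSpace G] [NonUnitalCStarAlgebra A]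
  {α : CStarAction G A} {μ : Measure G} [μ.IsHaarMeasure]

/-- The extension of a representation of the `L¹`-algebra to the crossed product. -/
def L1Rep.lift {K : Type (max u v)} [NormedAddCommGroup K] [InnerProductSpace ℂ K]
    [CompleteSpace K] (π : L1Rep α μ K) : CrossedProduct α μ →⋆ₙₐ[ℂ] (K →L[ℂ] K) :=
  CStarCompletion.lift π.toHom fun f => ConvAlg.rep_le_univNorm f π

@[simp] theorem L1Rep.lift_incl {K : Type (max u v)} [NormedAddCommGroup K]
    [InnerProductSpace ℂ K] [CompleteSpace K] (π : L1Rep α μ K) (f : ConvAlg α μ) :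
    π.lift (CStarCompletion.incl f) = π.toHom f := CStarCompletion.lift_incl _ _ f

theorem CrossedProduct.norm_le_of_forall_norm_lift_le {a : CrossedProduct α μ} {C : ℝ}
    (hC : 0 ≤ C) (h : ∀ (K : Type (max u v)) [NormedAddCommGroup K] [InnerProductSpace ℂ K]
      [CompleteSpace K] (π : L1Rep α μ K), ‖π.lift a‖ ≤ C) : ‖a‖ ≤ C := by
  refine le_of_forall_pos_le_add fun e he => ?_
  obtain ⟨f, hf⟩ := Metric.denseRange_iff.1 CStarCompletion.denseRange_incl a (e / 2) (half_pos he)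
  rw [dist_eq_norm] at hf
  have hf_norm : ‖CStarCompletion.incl f‖ ≤ C + e / 2 := by
    refine (CStarCompletion.norm_incl f).trans_le
      (ConvAlg.univNorm_le_of_rep (by positivity) fun K _ _ _ π => ?_)
    have hdist := NonUnitalStarAlgHom.norm_apply_le π.lift (a - CStarCompletion.incl f)
    rw [map_sub, L1Rep.lift_incl] at hdist
    linarith [h K π, norm_sub_norm_le (π.toHom f) (π.lift a),
      norm_sub_rev (π.toHom f) (π.lift a)]
  linarith [norm_sub_norm_le a (CStarCompletion.incl f)]

theorem CrossedProduct.ext_lift {a b : CrossedProduct α μ}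
    (h : ∀ (K : Type (max u v)) [NormedAddCommGroup K] [InnerProductSpace ℂ K] [CompleteSpace K]
      (π : L1Rep α μ K), π.lift a = π.lift b) : a = b := by
  refine sub_eq_zero.1 (norm_le_zero_iff.1 (norm_le_of_forall_norm_lift_le le_rfl
    fun K _ _ _ π => ?_))
  rw [map_sub, h K π, sub_self, norm_zero]

end Extension

namespace L1Rep

open scoped TensorProduct

variable {G : Type u} {A : Type v} [CommGroup G] [TopologicalSpace G] [IsTopologicalGroup G]
  [MeasurableSpace G] [BorelSpace G] [NonUnitalCStarAlgebra A]
  {α : CStarAction G A} {μ : Measure G} [μ.IsHaarMeasure]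
  {K : Type*} [NormedAddCommGroup K] [InnerProductSpace ℂ K] [CompleteSpace K]
  (π : L1Rep α μ K)

theorem norm_toHom_apply_le (f : ConvAlg α μ) (x : K) : ‖π.toHom f x‖ ≤ ‖x‖ * f.l1norm := by
  rw [mul_comm]
  exact ((π.toHom f).le_opNorm x).trans
    (mul_le_mul_of_nonneg_right (π.norm_le f) (norm_nonneg x))

theorem inner_toHom_toHom (f g : ConvAlg α μ) (x y : K) :
    inner ℂ (π.toHom f x) (π.toHom g y) = inner ℂ x (π.toHom (star f * g) y) := by
  rw [map_mul, map_star, ContinuousLinearMap.star_eq_adjoint, mul_apply_eq_comp,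
    ContinuousLinearMap.adjoint_inner_right]

/-- The map `f ⊗ x ↦ π(f) x`. -/
def evalTensor : ConvAlg α μ ⊗[ℂ] K →ₗ[ℂ] K :=
  TensorProduct.lift (LinearMap.mk₂ ℂ (fun f x => π.toHom f x) (by simp) (by simp) (by simp)
    (by simp))

@[simp] theorem evalTensor_tmul (f : ConvAlg α μ) (x : K) :
    π.evalTensor (f ⊗ₜ x) = π.toHom f x := rfl

theorem denseRange_evalTensor : DenseRange π.evalTensor := by
  refine (Submodule.dense_iff_topologicalClosure_eq_top
    (s := LinearMap.range π.evalTensor)).2 (top_le_iff.1 ?_)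
  rw [← π.nondegenerate]
  refine Submodule.topologicalClosure_mono (Submodule.span_le.2 ?_)
  rintro _ ⟨f, x, rfl⟩
  exact ⟨f ⊗ₜ x, rfl⟩

theorem clm_ext {S T : K →L[ℂ] K} (h : ∀ f x, S (π.toHom f x) = T (π.toHom f x)) : S = T := by
  refine ContinuousLinearMap.coeFn_injective
    (π.denseRange_evalTensor.equalizer S.continuous T.continuous (funext fun z => ?_))
  induction z using TensorProduct.induction_on with
  | zero => simp
  | tmul f x => exact h f x
  | add z w hz hw => simp only [Function.comp_apply, map_add] at hz hw ⊢; rw [hz, hw]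

section Unitary

variable {m : Module.End ℂ (ConvAlg α μ)}

theorem inner_evalTensor_rTensor (hm : ∀ f g, star (m f) * m g = star f * g)
    (z w : ConvAlg α μ ⊗[ℂ] K) :
    inner ℂ (π.evalTensor (m.rTensor K z)) (π.evalTensor (m.rTensor K w))
      = inner ℂ (π.evalTensor z) (π.evalTensor w) := by
  induction z using TensorProduct.induction_on with
  | zero => simp
  | add z z' hz hz' => simp only [map_add, inner_add_left, hz, hz']
  | tmul f x =>
    induction w using TensorProduct.induction_on with
    | zero => simp
    | add w w' hw hw' => simp only [map_add, inner_add_right, hw, hw']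
    | tmul g y => simp only [LinearMap.rTensor_tmul, evalTensor_tmul, inner_toHom_toHom, hm]

theorem norm_evalTensor_rTensor (hm : ∀ f g, star (m f) * m g = star f * g)
    (z : ConvAlg α μ ⊗[ℂ] K) : ‖π.evalTensor (m.rTensor K z)‖ = ‖π.evalTensor z‖ := by
  rw [@norm_eq_sqrt_re_inner ℂ, @norm_eq_sqrt_re_inner ℂ, π.inner_evalTensor_rTensor hm]

variable {S : Type*} [Group S] [TopologicalSpace S] (m : S →* Module.End ℂ (ConvAlg α μ))
  (hm : ∀ s f g, star (m s f) * m s g = star f * g)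
  (hc : ∀ f x, Continuous fun s => π.toHom (m s f) x)

/-- The unitary representation `s` of `S` with `s (π(f) x) = π(s f) x` determined by an action of
`S` on the convolution algebra that satisfies `(s f)⋆ (s g) = f⋆ g`. -/
def unitaryOf : IsometricRep S K :=
  IsometricRep.ofDense (m := (Module.End.rTensorAlgHom ℂ (ConvAlg α μ) K : _ →* _).comp m)
    π.denseRange_evalTensor (fun s z => π.norm_evalTensor_rTensor (hm s) z) fun z => by
      induction z using TensorProduct.induction_on with
      | zero => simpa using continuous_const
      | tmul f x => exact hc f x
      | add z w hz hw => simp only [map_add]; exact hz.add hw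

@[simp] theorem unitaryOf_apply (s : S) (f : ConvAlg α μ) (x : K) :
    π.unitaryOf m hm hc s (π.toHom f x) = π.toHom (m s f) x :=
  IsometricRep.ofDense_apply π.denseRange_evalTensor _ _ s (f ⊗ₜ x)

end Unitary

end L1Rep

namespace ConvAlg

open scoped BoundedContinuousFunction

section VanishingOff

variable {G A : Type*} [TopologicalSpace G] [NonUnitalCStarAlgebra A]

variable (A) in
/-- The Banach space of bounded continuous functions vanishing outside of a given set. -/
def vanishingOff (D : Set G) : Submodule ℂ (G →ᵇ A) where
  carrier := {f | ∀ t ∉ D, f t = 0}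
  add_mem' hf hg t ht := by simp [hf t ht, hg t ht]
  zero_mem' _ _ := rfl
  smul_mem' c f hf t ht := by simp [hf t ht]

theorem isClosed_vanishingOff (D : Set G) : IsClosed (vanishingOff A D : Set (G →ᵇ A)) := by
  have hinter : (vanishingOff A D : Set (G →ᵇ A)) = ⋂ t ∈ Dᶜ, {f : G →ᵇ A | f t = 0} := by
    ext f
    simp only [Set.mem_iInter]
    exact Iff.rfl
  rw [hinter]
  exact isClosed_biInter fun t _ => isClosed_eq
    (BoundedContinuousFunction.evalCLM ℂ t : _ →L[ℂ] A).continuous continuous_const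

instance (D : Set G) : CompleteSpace (vanishingOff A D) :=
  (isClosed_vanishingOff D).completeSpace_coe

variable {D : Set G}

theorem continuous_of_continuous_uncurry_vanishingOff {Y : Type*} [TopologicalSpace Y]
    (hD : IsCompact D) {Ψ : Y → vanishingOff A D}
    (hΨ : Continuous fun p : Y × G => (Ψ p.1).1 p.2) : Continuous Ψ := by
  refine continuous_iff_continuousAt.2 fun y₀ => Metric.tendsto_nhds.2 fun e he => ?_
  have hclose : ∀ᶠ y in 𝓝 y₀, ∀ t ∈ D, dist ((Ψ y).1 t) ((Ψ y₀).1 t) < e / 2 := by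
    refine hD.eventually_forall_of_forall_eventually
      (P := fun y t => dist ((Ψ y).1 t) ((Ψ y₀).1 t) < e / 2) fun t _ => ?_
    have hdist : Continuous fun p : Y × G => dist ((Ψ p.1).1 p.2) ((Ψ y₀).1 p.2) :=
      hΨ.dist ((Ψ y₀).1.continuous.comp continuous_snd)
    exact hdist.continuousAt.eventually_lt continuousAt_const (by simpa using half_pos he)
  filter_upwards [hclose] with y hy
  refine lt_of_le_of_lt ?_ (half_lt_self he)
  refine (BoundedContinuousFunction.dist_le (half_pos he).le).2 fun t => ?_
  by_cases ht : t ∈ D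
  · exact (hy t ht).le
  · rw [(Ψ y).2 t ht, (Ψ y₀).2 t ht, dist_self]
    exact (half_pos he).le

end VanishingOff

section L1Bounded

variable {G : Type u} {A : Type v} [Group G] [TopologicalSpace G] [IsTopologicalGroup G]
  [MeasurableSpace G] [NonUnitalCStarAlgebra A] {α : CStarAction G A} {μ : Measure G} {D : Set G}

/-- A function in the convolution algebra, as an element of the Banach space `vanishingOff A D`. -/
def toVanishingOff (f : ConvAlg α μ) (hf : ∀ t ∉ D, f t = 0) : vanishingOff A D :=
  ⟨⟨⟨f, f.continuous⟩, by
    obtain ⟨c, hc⟩ := f.hasCompactSupport.exists_bound_of_continuous f.continuous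
    exact ⟨c + c, fun s t => (dist_le_norm_add_norm _ _).trans (add_le_add (hc s) (hc t))⟩⟩, hf⟩

variable (α μ) in
/-- The inclusion of `vanishingOff A D` in the convolution algebra, for `D` compact. -/
def ofVanishingOff (hD : IsCompact D) : vanishingOff A D →ₗ[ℂ] ConvAlg α μ where
  toFun f := of ⟨⟨f.1, f.1.continuous⟩, HasCompactSupport.intro hD f.2⟩
  map_add' _ _ := rfl
  map_smul' _ _ := rfl

theorem ofVanishingOff_apply (hD : IsCompact D) (f : vanishingOff A D) (t : G) :
    ofVanishingOff α μ hD f t = f.1 t := rfl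

theorem l1norm_ofVanishingOff_le [BorelSpace G] [IsFiniteMeasureOnCompacts μ] (hD : IsCompact D)
    (f : vanishingOff A D) : (ofVanishingOff α μ hD f).l1norm ≤ μ.real D * ‖f‖ := by
  have hrestrict : ∫ t in D, ‖f.1 t‖ ∂μ = (ofVanishingOff α μ hD f).l1norm :=
    setIntegral_eq_integral_of_forall_compl_eq_zero fun t ht => by simp [f.2 t ht]
  rw [← hrestrict, mul_comm]
  exact (le_abs_self _).trans (norm_setIntegral_le_of_norm_le_const (f := fun t => ‖f.1 t‖)
    hD.measure_lt_top fun t _ => by simpa using f.1.norm_coe_le_norm t)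

variable {X : Type*} [NormedAddCommGroup X] [NormedSpace ℂ X]

/-- Linear maps on the convolution algebra that are bounded for the `L¹`-norm. -/
def IsL1Bounded (T : ConvAlg α μ →ₗ[ℂ] X) : Prop := ∃ C, ∀ f, ‖T f‖ ≤ C * f.l1norm

namespace IsL1Bounded

variable [BorelSpace G] [IsFiniteMeasureOnCompacts μ] {T : ConvAlg α μ →ₗ[ℂ] X} (hT : IsL1Bounded T)
include hT

theorem continuous_comp_ofVanishingOff (hD : IsCompact D) :
    Continuous (T ∘ₗ ofVanishingOff α μ hD) := by
  obtain ⟨C, hC⟩ := hT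
  refine AddMonoidHomClass.continuous_of_bound _ (|C| * μ.real D) fun f => (hC _).trans ?_
  calc C * (ofVanishingOff α μ hD f).l1norm
      ≤ |C| * (μ.real D * ‖f‖) :=
        mul_le_mul (le_abs_self C) (l1norm_ofVanishingOff_le hD f)
          (integral_nonneg fun _ => norm_nonneg _) (abs_nonneg C)
    _ = |C| * μ.real D * ‖f‖ := (mul_assoc _ _ _).symm

variable {Y : Type*} [TopologicalSpace Y] {Θ : Y → ConvAlg α μ}
  (hΘ : Continuous fun p : Y × G => Θ p.1 p.2)
include hΘ

theorem continuous_comp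
    (hsupp : ∀ y₀, ∃ N ∈ 𝓝 y₀, ∃ D, IsCompact D ∧ ∀ y ∈ N, ∀ t ∉ D, Θ y t = 0) :
    Continuous fun y => T (Θ y) := by
  refine continuous_iff_continuousAt.2 fun y₀ => ?_
  obtain ⟨N, hN, D, hD, hND⟩ := hsupp y₀
  have hΨ : Continuous fun y : N => toVanishingOff (Θ y) (hND y y.2) :=
    continuous_of_continuous_uncurry_vanishingOff hD
      (hΘ.comp ((continuous_subtype_val.comp continuous_fst).prodMk continuous_snd))
  have hTΘ : Continuous fun y : N => T (Θ y) := (hT.continuous_comp_ofVanishingOff hD).comp hΨ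
  exact (continuousOn_iff_continuous_domRestrict.2 hTΘ).continuousAt hN

theorem map_integral [CompleteSpace X] [R1Space Y] [MeasurableSpace Y] [OpensMeasurableSpace Y]
    {ρ : Measure Y} [IsFiniteMeasureOnCompacts ρ] {F : ConvAlg α μ}
    (hcs : HasCompactSupport fun p : Y × G => Θ p.1 p.2) (hF : ∀ t, F t = ∫ y, Θ y t ∂ρ) :
    T F = ∫ y, T (Θ y) ∂ρ := by
  have hD := hcs.isCompact.image continuous_snd
  have hzero : ∀ y t, (y, t) ∉ tsupport (fun p : Y × G => Θ p.1 p.2) → Θ y t = 0 :=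
    fun _ _ => image_eq_zero_of_notMem_tsupport
  let Ψ : Y → vanishingOff A (Prod.snd '' tsupport fun p : Y × G => Θ p.1 p.2) :=
    fun y => toVanishingOff (Θ y) fun t ht => hzero y t fun h => ht ⟨_, h, rfl⟩
  have hΨ : Integrable Ψ ρ :=
    (continuous_of_continuous_uncurry_vanishingOff hD hΘ).integrable_of_hasCompactSupport
      (HasCompactSupport.intro (hcs.isCompact.image continuous_fst) fun y hy =>
        Subtype.ext (BoundedContinuousFunction.ext fun t => hzero y t fun h => hy ⟨_, h, rfl⟩))
  let L : _ →L[ℂ] X := ⟨T ∘ₗ ofVanishingOff α μ hD, hT.continuous_comp_ofVanishingOff hD⟩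
  have hFΨ : F = ofVanishingOff α μ hD (∫ y, Ψ y ∂ρ) := by
    ext t
    rw [hF, ofVanishingOff_apply]
    exact ((BoundedContinuousFunction.evalCLM ℂ t).comp
      (vanishingOff A _).subtypeL).integral_comp_comm hΨ
  rw [hFΨ]
  exact (L.integral_comp_comm hΨ).symm

end IsL1Bounded

end L1Bounded

end ConvAlg

section Translation

open scoped Pointwise

namespace ConvAlg

section Group

variable {G : Type u} {A : Type v} [Group G] [TopologicalSpace G] [MeasurableSpace G]
  [NonUnitalCStarAlgebra A] {α : CStarAction G A} {μ : Measure G}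

/-- Composition with a continuous linear endomorphism of the coefficient algebra. -/
def mapCoeff : (A →L[ℂ] A) →* Module.End ℂ (ConvAlg α μ) where
  toFun l :=
    { toFun f := of ⟨⟨fun t => l (f t), l.continuous.comp f.continuous⟩,
        f.hasCompactSupport.comp_left (map_zero l)⟩
      map_add' f g := by ext t; exact map_add l _ _
      map_smul' c f := by ext t; exact map_smul l _ _ }
  map_one' := rfl
  map_mul' _ _ := rfl

theorem mapCoeff_apply (l : A →L[ℂ] A) (f : ConvAlg α μ) (t : G) : mapCoeff l f t = l (f t) := rfl

variable [IsTopologicalGroup G]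

/-- The action of `G` on the convolution algebra by twisted translations
`(s · f)(t) = α_s (f (s⁻¹ t))`. It is left multiplication by the canonical unitaries in the
multiplier algebra of the crossed product. -/
def translate : G →* Module.End ℂ (ConvAlg α μ) where
  toFun s :=
    { toFun f := of ⟨⟨fun t => α s (f (s⁻¹ * t)),
        α.continuous_comp continuous_const (f.continuous.comp (continuous_const_mul _))⟩,
        HasCompactSupport.intro (f.hasCompactSupport.isCompact.image (continuous_const_mul s))
          fun t ht => by
            have hst : s⁻¹ * t ∉ tsupport f := fun h => ht ⟨_, h, by simp⟩
            simp [image_eq_zero_of_notMem_tsupport hst]⟩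
      map_add' f g := by ext t; exact map_add (α s) _ _
      map_smul' c f := by ext t; exact map_smul (α s) _ _ }
  map_one' := by
    ext f t
    change α 1 (f (1⁻¹ * t)) = f t
    simp
  map_mul' s r := by
    ext f t
    change α (s * r) (f ((s * r)⁻¹ * t)) = α s (α r (f (r⁻¹ * (s⁻¹ * t))))
    rw [α.mul_apply, mul_inv_rev, mul_assoc]

theorem translate_apply (s : G) (f : ConvAlg α μ) (t : G) :
    translate s f t = α s (f (s⁻¹ * t)) := rfl

theorem translate_apply_eq_zero {N : Set G} {s t : G} (hs : s ∈ N) (f : ConvAlg α μ)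
    (ht : t ∉ N * tsupport f) : translate s f t = 0 := by
  have hst : s⁻¹ * t ∉ tsupport f := fun h => ht ⟨s, hs, _, h, by simp⟩
  rw [translate_apply, image_eq_zero_of_notMem_tsupport hst, map_zero]

theorem continuous_translate_apply (f : ConvAlg α μ) :
    Continuous fun p : G × G => translate p.1 f p.2 :=
  α.continuous_comp continuous_fst (f.continuous.comp (by fun_prop))

theorem IsL1Bounded.continuous_translate [LocallyCompactSpace G] [BorelSpace G]
    [IsFiniteMeasureOnCompacts μ] {X : Type*} [NormedAddCommGroup X] [NormedSpace ℂ X]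
    {T : ConvAlg α μ →ₗ[ℂ] X} (hT : IsL1Bounded T) (f : ConvAlg α μ) :
    Continuous fun s => T (translate s f) := by
  refine hT.continuous_comp (continuous_translate_apply f) fun s => ?_
  obtain ⟨N, hN, hNs⟩ := exists_compact_mem_nhds s
  exact ⟨N, hNs, N * tsupport f, hN.mul f.hasCompactSupport,
    fun _ hr _ => translate_apply_eq_zero hr f⟩

end Group

variable {G : Type u} {A : Type v} [CommGroup G] [TopologicalSpace G] [IsTopologicalGroup G]
  [MeasurableSpace G] [BorelSpace G] [NonUnitalCStarAlgebra A]
  {α : CStarAction G A} {μ : Measure G} [μ.IsHaarMeasure]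

theorem star_translate_mul (s : G) (f g : ConvAlg α μ) :
    star (translate s f) * translate s g = star f * g := by
  ext t
  rw [mul_apply, mul_apply,
    ← integral_mul_right_eq_self (fun r => star f r * α r (g (r⁻¹ * t))) s]
  refine integral_congr_ae (.of_forall fun r => ?_)
  simp only [star_apply, translate_apply, ← map_star, ← α.mul_apply, mul_inv_rev, mul_assoc]

theorem star_mapCoeff_mul {l : A →L[ℂ] A} (hl : ∀ a b, star (l a) * l b = star a * b)
    (f g : ConvAlg α μ) : star (mapCoeff l f) * mapCoeff l g = star f * g := by
  ext t
  rw [mul_apply, mul_apply]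
  refine integral_congr_ae (.of_forall fun r => ?_)
  simp only [star_apply, ← map_mul, mapCoeff_apply, hl]

theorem IsL1Bounded.map_mul {X : Type*} [NormedAddCommGroup X] [NormedSpace ℂ X]
    [CompleteSpace X] {T : ConvAlg α μ →ₗ[ℂ] X} (hT : IsL1Bounded T) (F k : ConvAlg α μ) :
    T (F * k) = ∫ s, T (mapCoeff (ContinuousLinearMap.mul ℂ A (F s)) (translate s k)) ∂μ := by
  refine hT.map_integral ?_ ?_ fun t => rfl
  · exact (F.continuous.comp continuous_fst).mul (continuous_translate_apply k)
  · refine HasCompactSupport.intro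
      (F.hasCompactSupport.isCompact.prod
        (F.hasCompactSupport.isCompact.mul k.hasCompactSupport)) ?_
    rintro ⟨s, t⟩ hst
    by_cases hs : s ∈ tsupport F
    · simp [mapCoeff_apply, translate_apply_eq_zero hs k fun ht => hst ⟨hs, ht⟩]
    · simp [mapCoeff_apply, image_eq_zero_of_notMem_tsupport hs]

end ConvAlg

variable {G : Type u} {A : Type v} [CommGroup G] [TopologicalSpace G] [IsTopologicalGroup G]
  [MeasurableSpace G] [BorelSpace G] [NonUnitalCStarAlgebra A]
  {α : CStarAction G A} {μ : Measure G} [μ.IsHaarMeasure]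

namespace CrossedProduct

open CStarCompletion

theorem norm_translate (s : G) (f : ConvAlg α μ) : ‖ConvAlg.translate s f‖ = ‖f‖ := by
  have hC : ∀ g : ConvAlg α μ, ‖g‖ * ‖g‖ = ‖star g * g‖ := fun g =>
    le_antisymm (PreCStarAlgebra.norm_mul_self_le g) ((norm_mul_le _ _).trans
      (mul_le_mul_of_nonneg_right (PreCStarAlgebra.norm_star_le g) (norm_nonneg g)))
  refine (mul_self_inj (norm_nonneg _) (norm_nonneg _)).1 ?_
  rw [hC, hC, ConvAlg.star_translate_mul]

theorem isL1Bounded_inclₗ : ConvAlg.IsL1Bounded (inclₗ (ConvAlg α μ)) :=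
  ⟨1, fun f => by simpa using (norm_incl f).trans_le f.univNorm_le_l1norm⟩

variable (α μ) in
/-- The canonical unitaries in the multiplier algebra of the crossed product, acting by left
multiplication. -/
def translation [LocallyCompactSpace G] : IsometricRep G (CrossedProduct α μ) :=
  IsometricRep.ofDense (e := inclₗ (ConvAlg α μ)) (m := ConvAlg.translate) denseRange_incl
    (fun s f => by simpa [norm_incl] using norm_translate s f)
    isL1Bounded_inclₗ.continuous_translate

variable [LocallyCompactSpace G]

@[simp] theorem translation_incl (s : G) (f : ConvAlg α μ) :
    translation α μ s (incl f) = incl (ConvAlg.translate s f) :=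
  IsometricRep.ofDense_apply (e := inclₗ (ConvAlg α μ)) denseRange_incl _ _ s f

theorem star_translation_mul (s : G) (a b : CrossedProduct α μ) :
    star (translation α μ s a) * translation α μ s b = star a * b := by
  have hc := (translation α μ s).continuous
  induction a using induction_on with
  | hp => exact isClosed_eq (hc.star.mul continuous_const) (continuous_star.mul continuous_const)
  | ih a =>
  induction b using induction_on with
  | hp => exact isClosed_eq (continuous_const.mul hc) (continuous_const.mul continuous_id)
  | ih b =>
  rw [translation_incl, translation_incl, ← incl_star, ← incl_mul, ConvAlg.star_translate_mul,
    incl_mul, incl_star]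

end CrossedProduct

theorem GroupCStar.of_mul [LocallyCompactSpace G] (f : C_c(G, ℂ))
    (b : GroupCStar μ) :
    GroupCStar.of μ f * b = ∫ s, f s • CrossedProduct.translation _ μ s b ∂μ := by
  have hf : Continuous f := map_continuous f
  induction b using CStarCompletion.induction_on with
  | hp =>
    refine isClosed_eq (continuous_const.mul continuous_id) (continuousOn_univ.1
      (continuousOn_integral_of_compact_support f.hasCompactSupport ?_ fun b s _ hs => ?_))
    · exact ((hf.comp continuous_snd).smul
        (IsometricRep.continuous_comp _ continuous_snd continuous_fst)).continuousOn
    · rw [image_eq_zero_of_notMem_tsupport hs, zero_smul]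
  | ih g =>
    simp only [CrossedProduct.translation_incl, ← CStarCompletion.incl_smul]
    exact (CStarCompletion.incl_mul _ _).symm.trans
      (CrossedProduct.isL1Bounded_inclₗ.map_mul (ConvAlg.of f) g)

end Translation

section Orbit

variable {G : Type u} {A : Type v} [CommGroup G] [TopologicalSpace G] [IsTopologicalGroup G]
  [MeasurableSpace G] [BorelSpace G] [NonUnitalCStarAlgebra A]
  {α : CStarAction G A} {μ : Measure G} [μ.IsHaarMeasure]
  {K : Type*} [NormedAddCommGroup K] [InnerProductSpace ℂ K] [CompleteSpace K]

/-- The linear map `f ↦ π(f) x`. -/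
def L1Rep.orbit (π : L1Rep α μ K) (x : K) : ConvAlg α μ →ₗ[ℂ] K where
  toFun f := π.toHom f x
  map_add' f g := by rw [map_add, add_apply]
  map_smul' c f := by rw [map_smul]; rfl

theorem L1Rep.isL1Bounded_orbit (π : L1Rep α μ K) (x : K) : ConvAlg.IsL1Bounded (π.orbit x) :=
  ⟨‖x‖, fun f => π.norm_toHom_apply_le f x⟩

end Orbit

section GroupRepresentations

open CStarCompletion

variable {G : Type u} [CommGroup G] [TopologicalSpace G] [IsTopologicalGroup G]
  [MeasurableSpace G] [BorelSpace G] {μ : Measure G} [μ.IsHaarMeasure]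

theorem GroupCStar.induction_on {p : GroupCStar μ → Prop} (a : GroupCStar μ)
    (hp : IsClosed {a | p a}) (ih : ∀ f : C_c(G, ℂ), p (GroupCStar.of μ f)) : p a :=
  CStarCompletion.induction_on a hp ih

theorem CStarAction.continuous_apply_right {S B : Type*} [Group S] [TopologicalSpace S]
    [NonUnitalCStarAlgebra B] (α : CStarAction S B) (s : S) : Continuous fun a => α s a :=
  α.continuous_comp continuous_const continuous_id

namespace IsometricRep

variable [LocallyCompactSpace G] [μ.IsInvInvariant] {K : Type u} [NormedAddCommGroup K]
  [InnerProductSpace ℂ K] [CompleteSpace K]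

variable (μ) in
/-- The representation of the group C⋆-algebra defined by a unitary representation. -/
def toGroupCStar (W : IsometricRep G K) : GroupCStar μ →⋆ₙₐ[ℂ] (K →L[ℂ] K) :=
  (W.toCovariantRep.toL1Rep μ).lift

theorem toGroupCStar_of (W : IsometricRep G K) (f : C_c(G, ℂ)) (x : K) :
    W.toGroupCStar μ (GroupCStar.of μ f) x = ∫ g, f g • W g x ∂μ := by
  rw [toGroupCStar, GroupCStar.of, L1Rep.lift_incl]
  rfl

theorem nondegenerate_toGroupCStar (W : IsometricRep G K) :
    (Submodule.span ℂ {y : K | ∃ a x, W.toGroupCStar μ a x = y}).topologicalClosure = ⊤ := by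
  rw [eq_top_iff, ← (W.toCovariantRep.toL1Rep μ).nondegenerate]
  refine Submodule.topologicalClosure_mono (Submodule.span_mono ?_)
  rintro _ ⟨f, x, rfl⟩
  exact ⟨incl f, x, by rw [toGroupCStar, L1Rep.lift_incl]⟩

end IsometricRep

end GroupRepresentations

section WeylPair

/-- The pairing `(g, h) ↦ β(h, g⁻¹)`, through which `G` acts on `C⋆(H)` when `H` acts on `C⋆(G)`
through `β`. -/
def dualPairing {G H : Type*} [CommGroup G] [Group H] (β : H →* G →* Circle) : G →* H →* Circle :=
  β.flip.comp invMonoidHom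

theorem dualPairing_apply {G H : Type*} [CommGroup G] [Group H] (β : H →* G →* Circle)
    (g : G) (h : H) : dualPairing β g h = β h g⁻¹ := rfl

theorem dualPairing_dualPairing {G H : Type*} [CommGroup G] [CommGroup H] (β : H →* G →* Circle) :
    dualPairing (dualPairing β) = β := by
  ext h g
  simp [dualPairing_apply]

theorem pairing_mul_inv {G H : Type*} [Group G] [Group H] (β : H →* G →* Circle) (h : H) (g : G) :
    (β h g : ℂ) * β h g⁻¹ = 1 := by
  rw [← Circle.coe_mul, ← map_mul, mul_inv_cancel, map_one, Circle.coe_one]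

theorem dualPairing_inv_mul {G H : Type*} [CommGroup G] [Group H] (β : H →* G →* Circle) (g : G)
    (h : H) : (dualPairing β g h⁻¹ : ℂ) * β h g⁻¹ = 1 := by
  rw [← Circle.coe_mul, dualPairing_apply, map_inv β, MonoidHom.inv_apply, inv_mul_cancel,
    Circle.coe_one]

/-- Two representations satisfying the Weyl form `V_h U_g = β(h, g) U_g V_h` of the canonical
commutation relations. -/
def IsWeylPair {G H K : Type*} [Group G] [TopologicalSpace G] [Group H] [TopologicalSpace H]
    [NormedAddCommGroup K] [NormedSpace ℂ K] (β : H →* G →* Circle) (U : IsometricRep G K)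
    (V : IsometricRep H K) : Prop :=
  ∀ h g x, V h (U g x) = (β h g : ℂ) • U g (V h x)

theorem IsWeylPair.swap {G H K : Type*} [CommGroup G] [TopologicalSpace G] [Group H]
    [TopologicalSpace H] [NormedAddCommGroup K] [NormedSpace ℂ K] {β : H →* G →* Circle}
    {U : IsometricRep G K} {V : IsometricRep H K} (hUV : IsWeylPair β U V) :
    IsWeylPair (dualPairing β) V U := fun g h x => by
  rw [hUV, smul_smul, dualPairing_apply, mul_comm, pairing_mul_inv, one_smul]

section Integral

variable {G H K : Type*} [Group G] [TopologicalSpace G] [MeasurableSpace G] [Group H]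
  [TopologicalSpace H] [MeasurableSpace H] [NormedAddCommGroup K] [NormedSpace ℂ K]

/-- The iterated integral `∫ f(g, h) U_g V_h x dg dh`. -/
def weylIntegral (μ : Measure G) (ν : Measure H) (U : IsometricRep G K) (V : IsometricRep H K)
    (f : C_c(G × H, ℂ)) (x : K) : K :=
  ∫ h, ∫ g, f (g, h) • U g (V h x) ∂μ ∂ν

theorem weylIntegral_swap [OpensMeasurableSpace G] [OpensMeasurableSpace H] {μ : Measure G}
    [IsFiniteMeasureOnCompacts μ] {ν : Measure H} [IsFiniteMeasureOnCompacts ν]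
    (U : IsometricRep G K) (V : IsometricRep H K) (f : C_c(G × H, ℂ)) (x : K) :
    weylIntegral μ ν U V f x = ∫ g, ∫ h, f (g, h) • U g (V h x) ∂ν ∂μ := by
  refine integral_integral_swap_of_hasCompactSupport
    (f := fun h g => f (g, h) • U g (V h x)) ?_ ?_
  · exact ((map_continuous f).comp continuous_swap).smul
      (U.continuous_comp continuous_snd (V.continuous_comp continuous_fst continuous_const))
  · exact (f.hasCompactSupport.comp_homeomorph (Homeomorph.prodComm H G)).smul_right

end Integral

theorem IsWeylPair.weylIntegral_eq {G H K : Type*} [CommGroup G] [TopologicalSpace G]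
    [MeasurableSpace G] [OpensMeasurableSpace G] [Group H] [TopologicalSpace H] [MeasurableSpace H]
    [OpensMeasurableSpace H] [NormedAddCommGroup K] [NormedSpace ℂ K]
    {μ : Measure G} [IsFiniteMeasureOnCompacts μ] {ν : Measure H} [IsFiniteMeasureOnCompacts ν]
    {β : H →* G →* Circle} {U : IsometricRep G K} {V : IsometricRep H K} (hUV : IsWeylPair β U V)
    {f : C_c(G × H, ℂ)} {f' : C_c(H × G, ℂ)}
    (hf : ∀ h g, f' (h, g) = (β h g⁻¹ : ℂ) * f (g, h)) (x : K) :
    weylIntegral ν μ V U f' x = weylIntegral μ ν U V f x := by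
  rw [weylIntegral_swap U V, weylIntegral]
  congr! 4 with g h
  rw [hUV, smul_smul, hf, mul_right_comm, mul_comm (β h g⁻¹ : ℂ), pairing_mul_inv, one_mul]

end WeylPair

section Duality

open CStarCompletion
open scoped CStarAlgebra

variable {G H : Type u} [CommGroup G] [TopologicalSpace G] [IsTopologicalGroup G]
  [MeasurableSpace G] [BorelSpace G] {μ : Measure G} [μ.IsHaarMeasure]
  [CommGroup H] [TopologicalSpace H]

/-- The action `δ` of `H` on `C⋆(G)` is given by pointwise multiplication by the functions
`β h`, which implicitly leaves `C_c(G)` invariant. -/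
def CStarAction.ActsBy (δ : CStarAction H (GroupCStar μ)) (β : H →* G →* Circle) : Prop :=
  ∀ (h : H) (f : C_c(G, ℂ)), ∃ f' : C_c(G, ℂ),
    (∀ g, f' g = (β h g : ℂ) * f g) ∧ δ h (GroupCStar.of μ f) = GroupCStar.of μ f'

variable {β : H →* G →* Circle} {δ : CStarAction H (GroupCStar μ)}

theorem CStarAction.ActsBy.apply_translation [LocallyCompactSpace G] (hδ : δ.ActsBy β) (h : H)
    (g : G) (a : GroupCStar μ) :
    δ h (CrossedProduct.translation _ μ g a)
      = (β h g : ℂ) • CrossedProduct.translation _ μ g (δ h a) := by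
  have hc := (CrossedProduct.translation (CStarAction.trivial G ℂ) μ g).continuous
  have hδc := δ.continuous_apply_right h
  induction a using GroupCStar.induction_on with
  | hp => exact isClosed_eq (hδc.comp hc) ((continuous_const_smul (β h g : ℂ)).comp (hc.comp hδc))
  | ih f =>
  obtain ⟨f', hf', hδf⟩ := hδ h f
  obtain ⟨k, hk, hδk⟩ := hδ h
    (ConvAlg.translate g (ConvAlg.of f : ConvAlg (CStarAction.trivial G ℂ) μ))
  have htrans (b : C_c(G, ℂ)) : CrossedProduct.translation _ μ g (GroupCStar.of μ b)
      = GroupCStar.of μ (ConvAlg.translate g (ConvAlg.of b : ConvAlg (.trivial G ℂ) μ)) :=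
    CrossedProduct.translation_incl g _
  rw [htrans, hδk, hδf, htrans]
  refine .trans ?_ (incl_smul _ _)
  congr 1
  ext t
  change k t = (β h g : ℂ) * f' (g⁻¹ * t)
  rw [hk, hf', ← mul_assoc, ← Circle.coe_mul, ← map_mul, mul_inv_cancel_left]
  rfl

/-- The covariant representation of `C⋆(G)` and `H` with given underlying unitary representations
of `G` and `H`. -/
def IsWeylPair.toCovariantRep [LocallyCompactSpace G] [μ.IsInvInvariant] {K : Type u}
    [NormedAddCommGroup K] [InnerProductSpace ℂ K] [CompleteSpace K] {U : IsometricRep G K}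
    {V : IsometricRep H K} (hUV : IsWeylPair β U V) (hδ : δ.ActsBy β) : CovariantRep δ K where
  rep := U.toGroupCStar μ
  unitary := V
  covariant h a x := by
    have hU : Continuous (U.toGroupCStar μ) := map_continuous _
    induction a using GroupCStar.induction_on with
    | hp =>
      exact isClosed_eq ((hU.comp (δ.continuous_apply_right h)).clm_apply continuous_const)
        ((V h).continuous.comp (hU.clm_apply continuous_const))
    | ih f =>
    obtain ⟨f', hf', hδf⟩ := hδ h f
    have hint : Integrable (fun g => f g • U g x) μ :=
      ((map_continuous f).smul (U.continuous_apply x)).integrable_of_hasCompactSupport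
        f.hasCompactSupport.smul_right
    rw [hδf, U.toGroupCStar_of, U.toGroupCStar_of, ← (V h).integral_comp_comm hint]
    congr! 2 with g
    rw [map_smul, hUV, smul_smul, hf', mul_comm]
  nondegenerate := U.nondegenerate_toGroupCStar

variable [MeasurableSpace H] {ν : Measure H}

theorem ConvAlg.continuous_mapCoeff_translation [LocallyCompactSpace G] (f : ConvAlg δ ν) :
    Continuous fun p : G × H =>
      ConvAlg.mapCoeff (CrossedProduct.translation (.trivial G ℂ) μ p.1) f p.2 :=
  (CrossedProduct.translation _ μ).continuous_comp continuous_fst (f.continuous.comp continuous_snd)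

variable [IsTopologicalGroup H] [BorelSpace H]

/-- The element of `C_c(H, C⋆(G))` defined by a function of two variables. -/
def ConvAlg.ofProd (δ : CStarAction H (GroupCStar μ)) (ν : Measure H) (f : C_c(G × H, ℂ)) :
    ConvAlg δ ν :=
  ConvAlg.of
    ⟨⟨fun h => GroupCStar.of μ (sliceLeft f h), continuous_sliceLeft f⟩,
      HasCompactSupport.intro (f.hasCompactSupport.isCompact.image continuous_snd) fun h hh => by
        have hslice : sliceLeft f h = 0 := by
          ext g
          exact image_eq_zero_of_notMem_tsupport (f := f) fun hgh => hh ⟨(g, h), hgh, rfl⟩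
        exact (congrArg (GroupCStar.of μ) hslice).trans incl_zero⟩

theorem ConvAlg.ofProd_apply (f : C_c(G × H, ℂ)) (h : H) :
    ConvAlg.ofProd δ ν f h = GroupCStar.of μ (sliceLeft f h) := rfl

variable [ν.IsHaarMeasure]

theorem CrossedProduct.ofProd_eq_incl (f : C_c(G × H, ℂ)) :
    CrossedProduct.ofProd δ ν f = incl (ConvAlg.ofProd δ ν f) := rfl

namespace L1Rep

variable {K : Type*} [NormedAddCommGroup K] [InnerProductSpace ℂ K] [CompleteSpace K]
  (π : L1Rep δ ν K)

/-- The unitary representation of `H` underlying a representation of `C⋆(G) ⋊ H`. -/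
def outerUnitary [LocallyCompactSpace H] : IsometricRep H K :=
  π.unitaryOf ConvAlg.translate ConvAlg.star_translate_mul fun f x =>
    (π.isL1Bounded_orbit x).continuous_translate f

theorem outerUnitary_apply [LocallyCompactSpace H] (h : H) (f : ConvAlg δ ν) (x : K) :
    π.outerUnitary h (π.toHom f x) = π.toHom (ConvAlg.translate h f) x :=
  π.unitaryOf_apply _ _ _ h f x

variable [LocallyCompactSpace G]

/-- The unitary representation of `G` underlying a representation of `C⋆(G) ⋊ H`. -/
def innerUnitary : IsometricRep G K :=
  π.unitaryOf (ConvAlg.mapCoeff.comp (CrossedProduct.translation _ μ).toHom)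
    (fun g => ConvAlg.star_mapCoeff_mul (CrossedProduct.star_translation_mul g)) fun f x =>
    (π.isL1Bounded_orbit x).continuous_comp (ConvAlg.continuous_mapCoeff_translation f) fun _ =>
      ⟨Set.univ, Filter.univ_mem, tsupport f, f.hasCompactSupport, fun g _ t ht => by
        simp [ConvAlg.mapCoeff_apply, image_eq_zero_of_notMem_tsupport ht]⟩

theorem innerUnitary_apply (g : G) (f : ConvAlg δ ν) (x : K) :
    π.innerUnitary g (π.toHom f x)
      = π.toHom (ConvAlg.mapCoeff (CrossedProduct.translation _ μ g) f) x :=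
  π.unitaryOf_apply _ _ _ g f x

theorem toHom_mapCoeff_mul_of (ξ : C_c(G, ℂ)) (k : ConvAlg δ ν) (x : K) :
    π.toHom (ConvAlg.mapCoeff (ContinuousLinearMap.mul ℂ _ (GroupCStar.of μ ξ)) k) x
      = ∫ g, ξ g • π.innerUnitary g (π.toHom k x) ∂μ := by
  have hξ : Continuous ξ := map_continuous ξ
  have hint := (π.isL1Bounded_orbit x).map_integral (ρ := μ)
    (F := ConvAlg.mapCoeff (ContinuousLinearMap.mul ℂ _ (GroupCStar.of μ ξ)) k)
    (Θ := fun g => ξ g • ConvAlg.mapCoeff (CrossedProduct.translation _ μ g) k)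
    ((hξ.comp continuous_fst).smul (ConvAlg.continuous_mapCoeff_translation k)) ?_
    fun t => GroupCStar.of_mul ξ (k t)
  · refine hint.trans (integral_congr_ae (.of_forall fun g => ?_))
    exact (map_smul (π.orbit x) _ _).trans (congrArg _ (π.innerUnitary_apply g k x).symm)
  · refine HasCompactSupport.intro
      (ξ.hasCompactSupport.isCompact.prod k.hasCompactSupport) ?_
    rintro ⟨g, t⟩ hgt
    by_cases hg : g ∈ tsupport ξ
    · have ht : t ∉ tsupport k := fun ht => hgt ⟨hg, ht⟩
      simp [ConvAlg.mapCoeff_apply, image_eq_zero_of_notMem_tsupport ht]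
    · simp [image_eq_zero_of_notMem_tsupport hg]

variable [LocallyCompactSpace H]

theorem isWeylPair (hδ : δ.ActsBy β) : IsWeylPair β π.innerUnitary π.outerUnitary := by
  intro h g x
  have hop : π.outerUnitary h * π.innerUnitary g
      = (β h g : ℂ) • (π.innerUnitary g * π.outerUnitary h) := by
    refine π.clm_ext fun f x => ?_
    rw [smul_apply, mul_apply_eq_comp, mul_apply_eq_comp, innerUnitary_apply,
      outerUnitary_apply, outerUnitary_apply, innerUnitary_apply, ← smul_apply, ← map_smul]
    congr 2
    ext t
    exact hδ.apply_translation h g _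
  exact congrArg (fun T : K →L[ℂ] K => T x) hop

theorem toHom_ofProd (f : C_c(G × H, ℂ)) (k : ConvAlg δ ν) (x : K) :
    π.toHom (ConvAlg.ofProd δ ν f) (π.toHom k x)
      = weylIntegral μ ν π.innerUnitary π.outerUnitary f (π.toHom k x) := by
  have hmul : π.toHom (ConvAlg.ofProd δ ν f) (π.toHom k x)
      = π.orbit x (ConvAlg.ofProd δ ν f * k) := by
    change _ = π.toHom _ x
    rw [map_mul, mul_apply_eq_comp]
  rw [hmul, (π.isL1Bounded_orbit x).map_mul, weylIntegral]
  congr! with h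
  rw [outerUnitary_apply]
  exact π.toHom_mapCoeff_mul_of (sliceLeft f h) _ x

end L1Rep

variable [LocallyCompactSpace G] [LocallyCompactSpace H] [μ.IsInvInvariant] [ν.IsInvInvariant]

theorem IsWeylPair.toL1Rep_ofProd {K : Type u}
    [NormedAddCommGroup K] [InnerProductSpace ℂ K] [CompleteSpace K] {U : IsometricRep G K}
    {V : IsometricRep H K} (hUV : IsWeylPair β U V) (hδ : δ.ActsBy β) (f : C_c(G × H, ℂ)) (x : K) :
    ((hUV.toCovariantRep hδ).toL1Rep ν).toHom (ConvAlg.ofProd δ ν f) x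
      = weylIntegral μ ν U V f x := by
  rw [CovariantRep.toL1Rep_apply, weylIntegral]
  congr! with h
  exact U.toGroupCStar_of (sliceLeft f h) (V h x)

variable {ε : CStarAction G (GroupCStar ν)} {f : C_c(G × H, ℂ)} {f' : C_c(H × G, ℂ)}

namespace L1Rep

variable {K : Type u} [NormedAddCommGroup K] [InnerProductSpace ℂ K] [CompleteSpace K]

/-- The representation of `C⋆(H) ⋊ G` with the same underlying unitary representations of `G` and
`H` as a given representation of `C⋆(G) ⋊ H`. -/
def dual (hδ : δ.ActsBy β) (hε : ε.ActsBy (dualPairing β)) (π : L1Rep δ ν K) : L1Rep ε μ K :=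
  ((π.isWeylPair hδ).swap.toCovariantRep hε).toL1Rep μ

theorem dual_toHom_ofProd (hδ : δ.ActsBy β) (hε : ε.ActsBy (dualPairing β)) (π : L1Rep δ ν K)
    (hf : ∀ h g, f' (h, g) = (β h g⁻¹ : ℂ) * f (g, h)) :
    (π.dual hδ hε).toHom (ConvAlg.ofProd ε μ f') = π.toHom (ConvAlg.ofProd δ ν f) :=
  π.clm_ext fun k x => by
    rw [π.toHom_ofProd, dual, IsWeylPair.toL1Rep_ofProd, (π.isWeylPair hδ).weylIntegral_eq hf]

end L1Rep

theorem norm_ofProd_le_of_twist (hδ : δ.ActsBy β) (hε : ε.ActsBy (dualPairing β))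
    (hf : ∀ h g, f' (h, g) = (β h g⁻¹ : ℂ) * f (g, h)) :
    ‖CrossedProduct.ofProd δ ν f‖ ≤ ‖CrossedProduct.ofProd ε μ f'‖ := by
  refine CrossedProduct.norm_le_of_forall_norm_lift_le (norm_nonneg _) fun K _ _ _ π => ?_
  rw [CrossedProduct.ofProd_eq_incl, L1Rep.lift_incl, ← π.dual_toHom_ofProd hδ hε hf,
    CrossedProduct.ofProd_eq_incl, ← L1Rep.lift_incl]
  exact NonUnitalStarAlgHom.norm_apply_le (π.dual hδ hε).lift _

theorem norm_ofProd_eq_of_twist (hδ : δ.ActsBy β) (hε : ε.ActsBy (dualPairing β))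
    (hf : ∀ h g, f' (h, g) = (β h g⁻¹ : ℂ) * f (g, h)) :
    ‖CrossedProduct.ofProd ε μ f'‖ = ‖CrossedProduct.ofProd δ ν f‖ := by
  have hδ' : δ.ActsBy (dualPairing (dualPairing β)) := (dualPairing_dualPairing β).symm ▸ hδ
  refine le_antisymm (norm_ofProd_le_of_twist hε hδ' fun g h => ?_)
    (norm_ofProd_le_of_twist hδ hε hf)
  rw [hf, ← mul_assoc, dualPairing_inv_mul, one_mul]

end Duality

section ElementaryTensorsDense

theorem hasCompactSupport_smul_prod {X Y R E : Type*} [TopologicalSpace X] [TopologicalSpace Y]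
    [Zero R] [Zero E] [SMulWithZero R E] {b : X → R} (hb : HasCompactSupport b) {f : Y → E}
    (hf : HasCompactSupport f) : HasCompactSupport fun p : X × Y => b p.1 • f p.2 := by
  refine HasCompactSupport.intro' (hb.isCompact.prod hf.isCompact)
    ((isClosed_tsupport b).prod (isClosed_tsupport f)) fun p hp => ?_
  by_cases hpb : p.1 ∈ tsupport b
  · rw [image_eq_zero_of_notMem_tsupport fun hpf => hp ⟨hpb, hpf⟩, smul_zero]
  · rw [image_eq_zero_of_notMem_tsupport hpb, zero_smul]

namespace ConvAlg

open scoped Pointwise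

variable {G : Type u} {A : Type v} [Group G] [TopologicalSpace G] [IsTopologicalGroup G]
  [MeasurableSpace G] [NonUnitalCStarAlgebra A] {α : CStarAction G A} {μ : Measure G}

/-- The untwisted translate `t ↦ f(s t)`. -/
def shift (s : G) (f : ConvAlg α μ) : ConvAlg α μ :=
  of ⟨⟨fun t => f (s * t), f.continuous.comp (continuous_const_mul s)⟩,
    f.hasCompactSupport.comp_homeomorph (Homeomorph.mulLeft s)⟩

theorem shift_apply (s : G) (f : ConvAlg α μ) (t : G) : shift s f t = f (s * t) := rfl

@[simp] theorem shift_one (f : ConvAlg α μ) : shift 1 f = f := by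
  ext t
  rw [shift_apply, one_mul]

theorem continuous_shift_apply (f : ConvAlg α μ) : Continuous fun p : G × G => shift p.1 f p.2 :=
  f.continuous.comp continuous_mul

theorem hasCompactSupport_smul_shift (b : C_c(G, ℂ)) (f : ConvAlg α μ) :
    HasCompactSupport fun p : G × G => b p.1 • shift p.1 f p.2 :=
  (hasCompactSupport_smul_prod b.hasCompactSupport f.hasCompactSupport).comp_homeomorph
    (Homeomorph.shearMulRight G)

variable [BorelSpace G] {X : Type*} [NormedAddCommGroup X] [NormedSpace ℂ X]
  {T : ConvAlg α μ →ₗ[ℂ] X}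

theorem IsL1Bounded.continuous_shift [LocallyCompactSpace G] [IsFiniteMeasureOnCompacts μ]
    (hT : IsL1Bounded T) (f : ConvAlg α μ) : Continuous fun s => T (shift s f) := by
  refine hT.continuous_comp (continuous_shift_apply f) fun s => ?_
  obtain ⟨N, hN, hNs⟩ := exists_compact_mem_nhds s
  exact ⟨N, hNs, N⁻¹ * tsupport f, hN.inv.mul f.hasCompactSupport, fun r hr t ht =>
    image_eq_zero_of_notMem_tsupport (f := f) fun h =>
      ht ⟨r⁻¹, Set.inv_mem_inv.2 hr, r * t, h, inv_mul_cancel_left r t⟩⟩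

variable [IsFiniteMeasureOnCompacts μ]

/-- The untwisted convolution `t ↦ ∫ b(s) f(s t) ds`, an average of translates of `f`. -/
def smear (b : C_c(G, ℂ)) (f : ConvAlg α μ) : ConvAlg α μ :=
  of ⟨⟨fun t => ∫ s, b s • shift s f t ∂μ, continuousOn_univ.1
      (continuousOn_integral_of_compact_support b.hasCompactSupport
        (((map_continuous b).comp continuous_snd).smul
          ((continuous_shift_apply f).comp continuous_swap)).continuousOn
        fun t s _ hs => by rw [image_eq_zero_of_notMem_tsupport hs, zero_smul])⟩,
    HasCompactSupport.intro
      ((hasCompactSupport_smul_shift b f).isCompact.image continuous_snd) fun t ht =>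
        integral_eq_zero_of_ae (.of_forall fun s =>
          image_eq_zero_of_notMem_tsupport (f := fun p : G × G => b p.1 • shift p.1 f p.2)
            (x := (s, t)) fun h => ht ⟨_, h, rfl⟩)⟩

namespace IsL1Bounded

variable [CompleteSpace X] (hT : IsL1Bounded T)
include hT

theorem map_smear (b : C_c(G, ℂ)) (f : ConvAlg α μ) :
    T (smear b f) = ∫ s, b s • T (shift s f) ∂μ := by
  simp only [← map_smul]
  exact hT.map_integral (Θ := fun s => b s • shift s f)
    (((map_continuous b).comp continuous_fst).smul (continuous_shift_apply f))
    (hasCompactSupport_smul_shift b f) fun t => rfl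

theorem map_smear_eq_integral_tensor [μ.IsMulRightInvariant] (b : C_c(G, ℂ)) (f : ConvAlg α μ) :
    T (smear b f)
      = ∫ r, T (tensor (b.comp (Homeomorph.divLeft r).toCocompactMap) (f r)) ∂μ := by
  refine hT.map_integral ?_ ?_ fun t => ?_
  · exact ((map_continuous b).comp continuous_div').smul (f.continuous.comp continuous_fst)
  · simpa [Function.comp_def, div_eq_mul_inv] using
      (hasCompactSupport_smul_prod b.hasCompactSupport f.hasCompactSupport).comp_homeomorph
        (((Homeomorph.refl G).prodCongr (Homeomorph.inv G)).trans
          ((Homeomorph.shearMulRight G).trans (Homeomorph.prodComm G G)))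
  · refine (integral_div_right_eq_self (fun s => b s • f (s * t)) t).symm.trans ?_
    simp only [div_mul_cancel]
    rfl

theorem eq_zero_of_tensor [LocallyCompactSpace G] [μ.IsOpenPosMeasure] [μ.IsMulRightInvariant]
    (htensor : ∀ b a, T (tensor b a) = 0) (f : ConvAlg α μ) : T f = 0 := by
  have hshift := eq_zero_of_forall_integral_smul_eq_zero (μ := μ) (hT.continuous_shift f)
    fun b => by simp only [← hT.map_smear, hT.map_smear_eq_integral_tensor, htensor, integral_zero]
  simpa using congrFun hshift 1

end IsL1Bounded

end ConvAlg

end ElementaryTensorsDense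

section Density

open CStarCompletion

variable {G H : Type u} [CommGroup G] [TopologicalSpace G] [IsTopologicalGroup G]
  [MeasurableSpace G] [BorelSpace G] {μ : Measure G} [μ.IsHaarMeasure]
  [CommGroup H] [TopologicalSpace H] [IsTopologicalGroup H]
  [MeasurableSpace H] [BorelSpace H] {ν : Measure H} (δ : CStarAction H (GroupCStar μ))

theorem ConvAlg.exists_ofProd_eq_tensor (b : C_c(H, ℂ)) (f : C_c(G, ℂ)) :
    ∃ k, ConvAlg.ofProd δ ν k = ConvAlg.tensor b (GroupCStar.of μ f) := by
  refine ⟨⟨⟨fun p => b p.2 • f p.1, ((map_continuous b).comp continuous_snd).smul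
    ((map_continuous f).comp continuous_fst)⟩, (hasCompactSupport_smul_prod b.hasCompactSupport
      f.hasCompactSupport).comp_homeomorph (Homeomorph.prodComm G H)⟩, ?_⟩
  ext h
  rw [ConvAlg.ofProd_apply, ConvAlg.tensor_apply]
  exact incl_smul (E := ConvAlg (CStarAction.trivial G ℂ) μ) (b h) (ConvAlg.of f)

namespace CrossedProduct

variable [ν.IsHaarMeasure]

variable (ν) in
/-- The canonical map `C_c(G × H) → C⋆(G) ⋊ H`, as a linear map. -/
def ofProdₗ : C_c(G × H, ℂ) →ₗ[ℂ] CrossedProduct δ ν where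
  toFun := ofProd δ ν
  map_add' f g := by
    simp only [ofProd_eq_incl, ← incl_add]
    congr 1
    ext h
    exact incl_add (E := ConvAlg (CStarAction.trivial G ℂ) μ) (ConvAlg.of (sliceLeft f h))
      (ConvAlg.of (sliceLeft g h))
  map_smul' c f := by
    simp only [ofProd_eq_incl, RingHom.id_apply, ← incl_smul]
    congr 1
    ext h
    exact incl_smul (E := ConvAlg (CStarAction.trivial G ℂ) μ) c (ConvAlg.of (sliceLeft f h))

theorem incl_tensor_mem_closure_ofProd (b : C_c(H, ℂ)) (a : GroupCStar μ) :
    incl (ConvAlg.tensor b a) ∈ (LinearMap.range (ofProdₗ ν δ)).topologicalClosure := by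
  induction a using GroupCStar.induction_on with
  | hp =>
    have htensor : Continuous fun a => inclₗ (ConvAlg δ ν) (ConvAlg.tensor b a) :=
      isL1Bounded_inclₗ.continuous_comp
        (((map_continuous b).comp continuous_snd).smul continuous_fst) fun _ =>
        ⟨Set.univ, Filter.univ_mem, tsupport b, b.hasCompactSupport, fun a _ t ht => by
          simp [image_eq_zero_of_notMem_tsupport ht]⟩
    exact (Submodule.isClosed_topologicalClosure _).preimage htensor
  | ih f =>
    obtain ⟨k, hk⟩ := ConvAlg.exists_ofProd_eq_tensor (ν := ν) δ b f
    exact Submodule.le_topologicalClosure _ ⟨k, by rw [← hk]; rfl⟩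

theorem denseRange_ofProdₗ [LocallyCompactSpace H] : DenseRange (ofProdₗ ν δ) := by
  let M := (LinearMap.range (ofProdₗ ν δ)).topologicalClosure
  have hM : IsClosed (M : Set (CrossedProduct δ ν)) := Submodule.isClosed_topologicalClosure _
  obtain ⟨C, hC⟩ := isL1Bounded_inclₗ (α := δ) (μ := ν)
  have hquot : ConvAlg.IsL1Bounded (M.mkQ ∘ₗ inclₗ (ConvAlg δ ν)) :=
    ⟨C, fun f => (Submodule.Quotient.norm_mk_le M _).trans (hC f)⟩
  refine fun a => induction_on (p := fun a => a ∈ M) a hM fun f =>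
    (Submodule.Quotient.mk_eq_zero M).1 (hquot.eq_zero_of_tensor (fun b a => ?_) f)
  exact (Submodule.Quotient.mk_eq_zero M).2 (incl_tensor_mem_closure_ofProd δ b a)

end CrossedProduct

end Density

section JointContinuity

variable {G H : Type u} [CommGroup G] [TopologicalSpace G] [IsTopologicalGroup G]
  [LocallyCompactSpace G] [MeasurableSpace G] [BorelSpace G] {μ : Measure G} [μ.IsHaarMeasure]

instance [μ.IsInvInvariant] : Nontrivial (GroupCStar μ) := by
  let x : EuclideanSpace ℂ PUnit.{u + 1} := EuclideanSpace.single PUnit.unit 1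
  let W := IsometricRep.trivial G (EuclideanSpace ℂ PUnit.{u + 1})
  by_contra hsub
  rw [not_nontrivial_iff_subsingleton] at hsub
  have hint (f : C_c(G, ℂ)) : ∫ g, f g • x ∂μ = 0 := by
    refine (W.toGroupCStar_of f x).symm.trans ?_
    rw [Subsingleton.elim (GroupCStar.of μ f) 0, map_zero, zero_apply]
  simpa [x] using congrFun (eq_zero_of_forall_integral_smul_eq_zero continuous_const hint) 1

theorem CStarAction.ActsBy.continuous_pairing [μ.IsInvInvariant] [CommGroup H]
    [TopologicalSpace H] {β : H →* G →* Circle} {δ : CStarAction H (GroupCStar μ)}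
    (hδ : δ.ActsBy β) : Continuous fun p : H × G => (β p.1 p.2 : ℂ) := by
  obtain ⟨a, ha⟩ := exists_ne (0 : GroupCStar μ)
  let U := CrossedProduct.translation (CStarAction.trivial G ℂ) μ
  have hleft : Continuous fun p : H × G => δ p.1 (U p.2 a) :=
    δ.continuous_comp continuous_fst (U.continuous_comp continuous_snd continuous_const)
  have hright : Continuous fun p : H × G => U p.2 (δ p.1 a) :=
    U.continuous_comp continuous_snd (δ.continuous_comp continuous_fst continuous_const)
  refine continuous_of_eq_smul hleft hright (fun p => hδ.apply_translation p.1 p.2 a) fun p => ?_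
  rw [← norm_ne_zero_iff, U.norm_map, δ.norm_apply]
  exact norm_ne_zero_iff.2 ha

end JointContinuity

section Twist

variable {G H : Type*} [CommGroup G] [TopologicalSpace G] [IsTopologicalGroup G]
  [CommGroup H] [TopologicalSpace H]

/-- The map `f ↦ [(h, g) ↦ β(h, g⁻¹) f(g, h)]`. -/
def twist (β : H →* G →* Circle) (hβ : Continuous fun p : H × G => (β p.1 p.2 : ℂ)) :
    C_c(G × H, ℂ) →ₗ[ℂ] C_c(H × G, ℂ) where
  toFun f := ⟨⟨fun p => (β p.1 p.2⁻¹ : ℂ) * f (p.2, p.1),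
      (hβ.comp (continuous_fst.prodMk continuous_snd.inv)).mul
        ((map_continuous f).comp continuous_swap)⟩,
    (f.hasCompactSupport.comp_homeomorph (Homeomorph.prodComm H G)).mul_left⟩
  map_add' f g := by ext p; exact mul_add _ _ _
  map_smul' c f := by ext p; exact mul_left_comm _ _ _

variable {β : H →* G →* Circle}

theorem twist_apply (hβ : Continuous fun p : H × G => (β p.1 p.2 : ℂ)) (f : C_c(G × H, ℂ)) (h : H)
    (g : G) : twist β hβ f (h, g) = (β h g⁻¹ : ℂ) * f (g, h) := rfl

theorem twist_twist [IsTopologicalGroup H] {γ : G →* H →* Circle}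
    (hβ : Continuous fun p : H × G => (β p.1 p.2 : ℂ))
    (hγ : Continuous fun p : G × H => (γ p.1 p.2 : ℂ))
    (hγβ : ∀ g h, (γ g h⁻¹ : ℂ) * β h g⁻¹ = 1) (f : C_c(G × H, ℂ)) :
    twist γ hγ (twist β hβ f) = f := by
  ext ⟨g, h⟩
  rw [twist_apply, twist_apply, ← mul_assoc, hγβ, one_mul]

end Twist

section Isomorphism

open CStarCompletion
open scoped CStarAlgebra

variable {G H : Type u} [CommGroup G] [TopologicalSpace G] [IsTopologicalGroup G]
  [LocallyCompactSpace G] [MeasurableSpace G] [BorelSpace G] {μ : Measure G} [μ.IsHaarMeasure]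
  [μ.IsInvInvariant] [CommGroup H] [TopologicalSpace H] [IsTopologicalGroup H]
  [LocallyCompactSpace H] [MeasurableSpace H] [BorelSpace H] {ν : Measure H} [ν.IsHaarMeasure]
  [ν.IsInvInvariant] {β : H →* G →* Circle} {δ : CStarAction H (GroupCStar μ)}
  {ε : CStarAction G (GroupCStar ν)}

/-- `twist`, as a linear equivalence. -/
def twistEquiv (hδ : δ.ActsBy β) (hε : ε.ActsBy (dualPairing β)) :
    C_c(G × H, ℂ) ≃ₗ[ℂ] C_c(H × G, ℂ) where
  __ := twist β hδ.continuous_pairing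
  invFun := twist (dualPairing β) hε.continuous_pairing
  left_inv := twist_twist _ _ (dualPairing_inv_mul β)
  right_inv := twist_twist _ _ fun h g => (mul_comm _ _).trans (dualPairing_inv_mul β g h)

theorem norm_ofProd_twist (hδ : δ.ActsBy β) (hε : ε.ActsBy (dualPairing β)) (f : C_c(G × H, ℂ)) :
    ‖CrossedProduct.ofProdₗ μ ε (twistEquiv hδ hε f)‖ = ‖CrossedProduct.ofProdₗ ν δ f‖ :=
  norm_ofProd_eq_of_twist hδ hε (twist_apply hδ.continuous_pairing f)

/-- The isometric extension of `twist` to the crossed products. -/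
def twistIsometry (hδ : δ.ActsBy β) (hε : ε.ActsBy (dualPairing β)) :
    CrossedProduct δ ν ≃ₗᵢ[ℂ] CrossedProduct ε μ :=
  (twistEquiv hδ hε).extendOfIsometry (CrossedProduct.ofProdₗ ν δ) (CrossedProduct.ofProdₗ μ ε)
    (CrossedProduct.denseRange_ofProdₗ δ) (CrossedProduct.denseRange_ofProdₗ ε)
    (norm_ofProd_twist hδ hε)

theorem twistIsometry_ofProd (hδ : δ.ActsBy β) (hε : ε.ActsBy (dualPairing β))
    (f : C_c(G × H, ℂ)) :
    twistIsometry hδ hε (CrossedProduct.ofProd δ ν f)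
      = CrossedProduct.ofProd ε μ (twist β hδ.continuous_pairing f) :=
  LinearEquiv.extendOfIsometry_eq (twistEquiv hδ hε) _ _ (CrossedProduct.denseRange_ofProdₗ δ)
    (CrossedProduct.denseRange_ofProdₗ ε) (norm_ofProd_twist hδ hε) f

theorem L1Rep.lift_dual_twistIsometry (hδ : δ.ActsBy β) (hε : ε.ActsBy (dualPairing β))
    {K : Type u} [NormedAddCommGroup K] [InnerProductSpace ℂ K] [CompleteSpace K]
    (π : L1Rep δ ν K) (a : CrossedProduct δ ν) :
    (π.dual hδ hε).lift (twistIsometry hδ hε a) = π.lift a := by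
  refine (CrossedProduct.denseRange_ofProdₗ δ).induction_on a (isClosed_eq
    ((map_continuous _).comp (twistIsometry hδ hε).continuous) (map_continuous _)) fun f => ?_
  change (π.dual hδ hε).lift (twistIsometry hδ hε (CrossedProduct.ofProd δ ν f))
    = π.lift (CrossedProduct.ofProd δ ν f)
  rw [twistIsometry_ofProd, CrossedProduct.ofProd_eq_incl, CrossedProduct.ofProd_eq_incl,
    L1Rep.lift_incl, L1Rep.lift_incl]
  exact π.dual_toHom_ofProd hδ hε (twist_apply hδ.continuous_pairing f)

theorem L1Rep.lift_twistIsometry_symm (hδ : δ.ActsBy β) (hε : ε.ActsBy (dualPairing β))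
    {K : Type u} [NormedAddCommGroup K] [InnerProductSpace ℂ K] [CompleteSpace K]
    (π : L1Rep δ ν K) (b : CrossedProduct ε μ) :
    π.lift ((twistIsometry hδ hε).symm b) = (π.dual hδ hε).lift b := by
  rw [← π.lift_dual_twistIsometry hδ hε, LinearIsometryEquiv.apply_symm_apply]

/-- The isomorphism `C⋆(G) ⋊ H ≃ C⋆(H) ⋊ G` extending `twist`. -/
def crossedProductDuality (hδ : δ.ActsBy β) (hε : ε.ActsBy (dualPairing β)) :
    CrossedProduct δ ν ≃⋆ₐ[ℂ] CrossedProduct ε μ :=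
  StarAlgEquiv.symm
    { (twistIsometry hδ hε).symm.toLinearEquiv with
      map_mul' a b := CrossedProduct.ext_lift fun K _ _ _ π => by
        change π.lift ((twistIsometry hδ hε).symm (a * b))
          = π.lift ((twistIsometry hδ hε).symm a * (twistIsometry hδ hε).symm b)
        simp only [map_mul, L1Rep.lift_twistIsometry_symm]
      map_star' a := CrossedProduct.ext_lift fun K _ _ _ π => by
        change π.lift ((twistIsometry hδ hε).symm (star a))
          = π.lift (star ((twistIsometry hδ hε).symm a))
        simp only [map_star, L1Rep.lift_twistIsometry_symm] }

theorem crossedProductDuality_ofProd (hδ : δ.ActsBy β) (hε : ε.ActsBy (dualPairing β))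
    (f : C_c(G × H, ℂ)) : crossedProductDuality hδ hε (CrossedProduct.ofProd δ ν f)
      = CrossedProduct.ofProd ε μ (twist β hδ.continuous_pairing f) :=
  twistIsometry_ofProd hδ hε f

end Isomorphism

end

theorem mainTheorem6_general {G H : Type u}
    [CommGroup G] [TopologicalSpace G] [IsTopologicalGroup G] [LocallyCompactSpace G]
    [MeasurableSpace G] [BorelSpace G] (μ : Measure G) [μ.IsHaarMeasure] [μ.IsInvInvariant]
    [CommGroup H] [TopologicalSpace H] [IsTopologicalGroup H] [LocallyCompactSpace H]
    [MeasurableSpace H] [BorelSpace H] (ν : Measure H) [ν.IsHaarMeasure] [ν.IsInvInvariant]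
    (β : H →* G →* Circle) (δ : CStarAction H (GroupCStar μ)) (hδ : δ.ActsBy β)
    (ε : CStarAction G (GroupCStar ν)) (hε : ε.ActsBy (dualPairing β)) :
    ∃ φ : C_c(G × H, ℂ) → C_c(H × G, ℂ),
      (∀ f h g, φ f (h, g) = (β h g⁻¹ : ℂ) * f (g, h)) ∧
      ∃ Φ : CrossedProduct δ ν ≃⋆ₐ[ℂ] CrossedProduct ε μ,
        ∀ f, Φ (CrossedProduct.ofProd δ ν f) = CrossedProduct.ofProd ε μ (φ f) :=
  ⟨twist β hδ.continuous_pairing, twist_apply hδ.continuous_pairing,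
    crossedProductDuality hδ hε, crossedProductDuality_ofProd hδ hε⟩

theorem mainTheorem6 {G H : Type u}
    -- a locally compact (Hausdorff) abelian group `G`, written multiplicatively, with Haar measure
    [CommGroup G] [TopologicalSpace G] [IsTopologicalGroup G] [LocallyCompactSpace G] [T2Space G]
    [MeasurableSpace G] [BorelSpace G] (μ : Measure G) [μ.IsHaarMeasure] [μ.Regular]
    -- a locally compact (Hausdorff) abelian group `H`, with Haar measure
    [CommGroup H] [TopologicalSpace H] [IsTopologicalGroup H] [LocallyCompactSpace H] [T2Space H]
    [MeasurableSpace H] [BorelSpace H] (ν : Measure H) [ν.IsHaarMeasure] [ν.Regular]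
    -- `H` is, algebraically, a subgroup of the dual group (its topology is its own)
    (j : H →* PontryaginDual G) (_hj : Function.Injective j)
    -- `δ_h(f) = [g ↦ h(g) f(g)]` extends to a strongly continuous action of `H` on `C⋆(G)`
    (δ : CStarAction H (GroupCStar μ))
    (_hδ : ∀ (h : H) (f : C_c(G, ℂ)), ∃ f' : C_c(G, ℂ),
      (∀ g, f' g = (j h g : ℂ) * f g) ∧ δ h (GroupCStar.of μ f) = GroupCStar.of μ f')
    -- `ε_g(f) = [h ↦ h(g⁻¹) f(h)]` extends to a strongly continuous action of `G` on `C⋆(H)`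
    (ε : CStarAction G (GroupCStar ν))
    (_hε : ∀ (g : G) (f : C_c(H, ℂ)), ∃ f' : C_c(H, ℂ),
      (∀ h, f' h = (j h g⁻¹ : ℂ) * f h) ∧ ε g (GroupCStar.of ν f) = GroupCStar.of ν f') :
    ∃ φ : C_c(G × H, ℂ) → C_c(H × G, ℂ),
      (∀ f h g, φ f (h, g) = (j h g⁻¹ : ℂ) * f (g, h)) ∧
      ∃ Φ : CrossedProduct δ ν ≃⋆ₐ[ℂ] CrossedProduct ε μ,
        ∀ f, Φ (CrossedProduct.ofProd δ ν f) = CrossedProduct.ofProd ε μ (φ f) := by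
  let β : H →* G →* Circle :=
    { toFun h := (j h).toMonoidHom
      map_one' := by rw [map_one]; rfl
      map_mul' h k := by rw [map_mul]; rfl }
  exact mainTheorem6_general μ ν β δ _hδ ε _hε
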